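/- Let $G\rightrightarrows M$ be a Lie groupoid with source $s$, target $t$ and units $1_x$. Let $A_x=\ker(ds_{1_x})$ be the fibre at $x\in M$ of its Lie algebroid, with anchor $\rho_x=dt_{1_x}|_{A_x}:A_x\to T_xM$. A differential form $\alpha$ on $M$ is called basic if $s^*\alpha=t^*\alpha$; write $\Omega^k_{\mathrm{bas}}(G)$ for the space of basic $k$-forms. For closed basic forms $\omega\in\Omega^2_{\mathrm{bas}}(G)$ and $\eta\in\Omega^1_{\mathrm{bas}}(G)$, put $\flat_x(v)=\iota_v\omega_x+\eta_x(v)\eta_x$, and let $\flat_{(\omega,\eta)}$ at $x\in M$ denote the cochain map $$\bigl(0\to A_x\xrightarrow{\rho_x}T_xM\to 0\to 0\bigr)\longrightarrow\bigl(0\to 0\to T_x^*M\xrightarrow{\rho_x^*}A_x^*\to 0\bigr)$$ given by $\flat_x:T_xM\to T_x^*M$ in the middle degree and by $0$ in the other degrees. A $0$-shifted cosymplectic structure on $G\rightrightarrows M$ is a pair $(\omega,\eta)$ of closed basic forms as above such that $\eta$ vanishes nowhere and $\flat_{(\omega,\eta)}$ is a quasi-isomorphism at every $x\in M$. A Morita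 map $\phi:(G'\rightrightarrows M')\to(G\rightrightarrows M)$ is a morphism of Lie groupoids that is essentially surjective, i.e. $G\times_{s,M,\phi}M'\to M$, $(g,y)\mapsto t(g)$, is a surjective submersion, and fully faithful, i.e. $(s',t',\phi)$ is a diffeomorphism from $G'$ onto the fibre product $(M'\times M')\times_{M\times M}G$ of $\phi\times\phi$ and $(s,t)$. Then, for every Lie groupoid $G\rightrightarrows M$: 1. For all closed basic forms $\omega\in\Omega^2_{\mathrm{bas}}(G)$ and $\eta\in\Omega^1_{\mathrm{bas}}(G)$: if $\flat_{(\omega,\eta)}$ is a quasi-isomorphism at $x\in M$, then it is a quasi-isomorphism at every point of the groupoid orbit $\{t(g): s(g)=x\}$ through $x$. 2. Let $\phi:(G'\rightrightarrows M')\to(G\rightrightarrows M)$ be a Morita map. For all closed basic forms $\omega\in\Omega^2_{\mathrm{bas}}(G)$ and $\eta\in\Omega^1_{\mathrm{bas}}(G)$, the cochain map $\flat_{(\omega,\eta)}$ is a quasi-isomorphism at all points of $M$ if and only if $\flat_{(\phi^*\omega,\phi^*\eta)}$ is a quasi-isomorphism at all points of $M'$. Moreover, pullback along $\phi$ maps $\Omega^k_{\mathrm{bas}}(G)$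 into $\Omega^k_{\mathrm{bas}}(G')$ for every $k$, and $(\omega,\eta)\mapsto(\phi^*\omega,\phi^*\eta)$ is a bijection from the set of $0$-shifted cosymplectic structures on $G\rightrightarrows M$ onto the set of those on $G'\rightrightarrows M'$. -/

import Mathlib

open CategoryTheory
open scoped Manifold ContDiff

noncomputable section

/-! ### Differential forms on manifolds -/

/-- A (not necessarily smooth) field of alternating `k`-forms on the tangent spaces of an
`m`-dimensional manifold `M`. -/
abbrev FormField (m k : ℕ) (M : Type*) [TopologicalSpace M]
    [ChartedSpace (EuclideanSpace ℝ (Fin m)) M] : Type _ :=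
  ∀ x : M, TangentSpace (𝓡 m) x [⋀^Fin k]→L[ℝ] ℝ

namespace FormField

variable {m k : ℕ} {M : Type*} [TopologicalSpace M] [ChartedSpace (EuclideanSpace ℝ (Fin m)) M]
  {n : ℕ} {N : Type*} [TopologicalSpace N] [ChartedSpace (EuclideanSpace ℝ (Fin n)) N]

/-- The pullback `(f^* α)_x (v₁, …, v_k) = α_{f x} (df_x v₁, …, df_x v_k)`. -/
def pullback (f : N → M) (α : FormField m k M) : FormField n k N :=
  fun x => (α (f x)).compContinuousLinearMap (mfderiv (𝓡 n) (𝓡 m) f x)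

/-- Functoriality of the pullback. -/
theorem pullback_comp {l : ℕ} {L : Type*} [TopologicalSpace L]
    [ChartedSpace (EuclideanSpace ℝ (Fin l)) L] {f : N → M} {g : L → N}
    (hf : ContMDiff (𝓡 n) (𝓡 m) ∞ f) (hg : ContMDiff (𝓡 l) (𝓡 n) ∞ g) (α : FormField m k M) :
    (α.pullback (n := n) f).pullback (n := l) g = α.pullback (n := l) (f ∘ g) := by
  funext x
  have h := mfderiv_comp x ((hf (g x)).mdifferentiableAt (by simp))
    ((hg x).mdifferentiableAt (by simp))
  change _ = (α (f (g x))).compContinuousLinearMap (mfderiv (𝓡 l) (𝓡 m) (f ∘ g) x)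
  rw [h]
  rfl

/-- The local representative of a field of forms in the chart around `x₀`: its pullback under the
inverse of that chart (it is only meaningful on the target of the chart, an open set). -/
def inChart (α : FormField m k M) (x₀ : M) :
    EuclideanSpace ℝ (Fin m) → EuclideanSpace ℝ (Fin m) [⋀^Fin k]→L[ℝ] ℝ :=
  fun y => (α ((extChartAt (𝓡 m) x₀).symm y)).compContinuousLinearMap
    (mfderiv 𝓘(ℝ, EuclideanSpace ℝ (Fin m)) (𝓡 m) (extChartAt (𝓡 m) x₀).symm y)

/-- A field of forms is smooth, that is, a differential form, if all its local representatives
are smooth. -/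
def IsSmooth (α : FormField m k M) : Prop :=
  ∀ x₀ : M, ContDiffOn ℝ ∞ (α.inChart x₀) (extChartAt (𝓡 m) x₀).target

/-- A form is closed if the exterior derivatives of all its local representatives vanish. -/
def IsClosed (α : FormField m k M) : Prop :=
  ∀ x₀ : M, ∀ y ∈ (extChartAt (𝓡 m) x₀).target, extDeriv (α.inChart x₀) y = 0

end FormField

/-! ### Lie groupoids -/

/-- A Lie groupoid `G ⇉ M` with an `m`-dimensional manifold of objects and an `n`-dimensional
manifold of arrows. The partial multiplication is recorded as a total function of which only
the values `mul g h` on composable pairs (`src g = tgt h`) matter; it is required to be smooth on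
the embedded submanifold of composable pairs of `G × G`. -/
structure LieGroupoid (m n : ℕ) (M G : Type*)
    [TopologicalSpace M] [ChartedSpace (EuclideanSpace ℝ (Fin m)) M] [IsManifold (𝓡 m) ∞ M]
    [TopologicalSpace G] [ChartedSpace (EuclideanSpace ℝ (Fin n)) G] [IsManifold (𝓡 n) ∞ G] where
  src : G → M
  tgt : G → M
  mul : G → G → G
  unit : M → G
  inv : G → G
  src_mul : ∀ g h, src g = tgt h → src (mul g h) = src h
  tgt_mul : ∀ g h, src g = tgt h → tgt (mul g h) = tgt g
  mul_assoc : ∀ g h k, src g = tgt h → src h = tgt k → mul (mul g h) k = mul g (mul h k)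
  src_unit : ∀ x, src (unit x) = x
  tgt_unit : ∀ x, tgt (unit x) = x
  unit_mul : ∀ g, mul (unit (tgt g)) g = g
  mul_unit : ∀ g, mul g (unit (src g)) = g
  src_inv : ∀ g, src (inv g) = tgt g
  tgt_inv : ∀ g, tgt (inv g) = src g
  inv_mul : ∀ g, mul (inv g) g = unit (src g)
  mul_inv : ∀ g, mul g (inv g) = unit (tgt g)
  submersion_src : Manifold.IsSubmersion (𝓡 n) (𝓡 m) ∞ src
  submersion_tgt : Manifold.IsSubmersion (𝓡 n) (𝓡 m) ∞ tgt
  smooth_mul : ContMDiffOn ((𝓡 n).prod (𝓡 n)) (𝓡 n) ∞ (fun p : G × G => mul p.1 p.2)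
    {p | src p.1 = tgt p.2}
  smooth_unit : ContMDiff (𝓡 m) (𝓡 n) ∞ unit
  smooth_inv : ContMDiff (𝓡 n) (𝓡 n) ∞ inv

/-! ### Three-term complexes of real vector spaces -/

namespace ThreeTerm

variable (V₀ V₁ V₂ : Type) [AddCommGroup V₀] [Module ℝ V₀] [AddCommGroup V₁] [Module ℝ V₁]
  [AddCommGroup V₂] [Module ℝ V₂]

/-- The objects of the complex `V₀ → V₁ → V₂ → 0 → ⋯`. -/
def obj : ℕ → ModuleCat.{0} ℝ
  | 0 => ModuleCat.of ℝ V₀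
  | 1 => ModuleCat.of ℝ V₁
  | 2 => ModuleCat.of ℝ V₂
  | _ + 3 => ModuleCat.of ℝ PUnit

variable {V₀ V₁ V₂}

/-- The differentials of the complex `V₀ → V₁ → V₂ → 0 → ⋯`. -/
def diff (f : V₀ →ₗ[ℝ] V₁) (g : V₁ →ₗ[ℝ] V₂) : ∀ i, obj V₀ V₁ V₂ i ⟶ obj V₀ V₁ V₂ (i + 1)
  | 0 => ModuleCat.ofHom f
  | 1 => ModuleCat.ofHom g
  | _ + 2 => 0

/-- The cochain complex `0 → V₀ → V₁ → V₂ → 0`, with `V₀` placed in degree `0`. -/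
def complex (f : V₀ →ₗ[ℝ] V₁) (g : V₁ →ₗ[ℝ] V₂) (h : g ∘ₗ f = 0) :
    CochainComplex (ModuleCat.{0} ℝ) ℕ :=
  CochainComplex.of (obj V₀ V₁ V₂) (diff f g) (by
    rintro (_ | _ | i)
    · change ModuleCat.ofHom f ≫ ModuleCat.ofHom g = 0
      rw [← ModuleCat.ofHom_comp, h]; rfl
    · exact Limits.comp_zero
    · exact Limits.comp_zero)

variable {W₀ W₁ W₂ : Type} [AddCommGroup W₀] [Module ℝ W₀] [AddCommGroup W₁] [Module ℝ W₁]
  [AddCommGroup W₂] [Module ℝ W₂]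

/-- The cochain map between three-term complexes given by a commutative ladder. -/
def map {f : V₀ →ₗ[ℝ] V₁} {g : V₁ →ₗ[ℝ] V₂} {h : g ∘ₗ f = 0}
    {f' : W₀ →ₗ[ℝ] W₁} {g' : W₁ →ₗ[ℝ] W₂} {h' : g' ∘ₗ f' = 0}
    (a : V₀ →ₗ[ℝ] W₀) (b : V₁ →ₗ[ℝ] W₁) (c : V₂ →ₗ[ℝ] W₂)
    (hab : f' ∘ₗ a = b ∘ₗ f) (hbc : g' ∘ₗ b = c ∘ₗ g) :
    complex f g h ⟶ complex f' g' h' :=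
  CochainComplex.ofHom
    (fun
      | 0 => ModuleCat.ofHom a
      | 1 => ModuleCat.ofHom b
      | 2 => ModuleCat.ofHom c
      | _ + 3 => 0)
    (by
      intro i
      simp only [complex, CochainComplex.of_d]
      rcases i with _ | _ | i
      · change ModuleCat.ofHom a ≫ ModuleCat.ofHom f' = ModuleCat.ofHom f ≫ ModuleCat.ofHom b
        rw [← ModuleCat.ofHom_comp, ← ModuleCat.ofHom_comp, hab]
      · change ModuleCat.ofHom b ≫ ModuleCat.ofHom g' = ModuleCat.ofHom g ≫ ModuleCat.ofHom c
        rw [← ModuleCat.ofHom_comp, ← ModuleCat.ofHom_comp, hbc]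
      · exact Limits.comp_zero.trans Limits.zero_comp.symm)

end ThreeTerm

namespace LieGroupoid

variable {m n : ℕ} {M G : Type*}
  [TopologicalSpace M] [ChartedSpace (EuclideanSpace ℝ (Fin m)) M] [IsManifold (𝓡 m) ∞ M]
  [TopologicalSpace G] [ChartedSpace (EuclideanSpace ℝ (Fin n)) G] [IsManifold (𝓡 n) ∞ G]
  (𝒢 : LieGroupoid m n M G)

/-- The orbit through `x`: all targets of arrows that start at `x`. -/
def orbit (x : M) : Set M := {y | ∃ g, 𝒢.src g = x ∧ 𝒢.tgt g = y}

/-- A form `α` on the objects is basic if `t^* α = s^* α`. -/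
def IsBasic {k : ℕ} (α : FormField m k M) : Prop :=
  α.pullback (n := n) 𝒢.tgt = α.pullback 𝒢.src

/-- The space of basic differential `k`-forms, as a set of fields of forms. -/
def basicForms (k : ℕ) : Set (FormField m k M) := {α | α.IsSmooth ∧ 𝒢.IsBasic α}

/-- The fibre `A_x = ker (ds)_{1_x}` of the Lie algebroid. -/
def algebroid (x : M) : Submodule ℝ (TangentSpace (𝓡 n) (𝒢.unit x)) :=
  LinearMap.ker (mfderiv (𝓡 n) (𝓡 m) 𝒢.src (𝒢.unit x)).toLinearMap

/-- The differential `(dt)_{1_x}`, as a map into `T_x M` (recall that `t (1_x) = x`). -/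
def dtgtUnit (x : M) : TangentSpace (𝓡 n) (𝒢.unit x) →ₗ[ℝ] TangentSpace (𝓡 m) x :=
  (mfderiv (𝓡 n) (𝓡 m) 𝒢.tgt (𝒢.unit x)).toLinearMap

/-- The anchor `ρ_x = (dt)_{1_x} |_{A_x}`. -/
def anchor (x : M) : 𝒢.algebroid x →ₗ[ℝ] TangentSpace (𝓡 m) x :=
  𝒢.dtgtUnit x ∘ₗ (𝒢.algebroid x).subtype

end LieGroupoid

/-- The Lichnerowicz map `♭(v) = ι_v ω + η(v) η` at a point `x`. -/
def lichnerowicz {m : ℕ} {M : Type*} [TopologicalSpace M]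
    [ChartedSpace (EuclideanSpace ℝ (Fin m)) M] (ϖ : FormField m 2 M) (η : FormField m 1 M)
    (x : M) : TangentSpace (𝓡 m) x →ₗ[ℝ] Module.Dual ℝ (TangentSpace (𝓡 m) x) :=
  LinearMap.mk₂ ℝ (fun v w => ϖ x ![v, w] + η x ![v] * η x ![w])
    (by
      intro v v' w
      have h1 := (ϖ x).vecCons_add ![w] v v'
      have h2 := (η x).vecCons_add ![] v v'
      rw [h1, h2]; ring)
    (by
      intro c v w
      have h1 := (ϖ x).vecCons_smul ![w] c v
      have h2 := (η x).vecCons_smul ![] c v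
      rw [h1, h2]; simp only [smul_eq_mul]; ring)
    (by
      intro v w w'
      have h (z) : Function.update ![v, w] 1 z = ![v, z] := by ext i; fin_cases i <;> rfl
      have h1 := (ϖ x).map_update_add ![v, w] 1 w w'
      have h2 := (η x).vecCons_add ![] w w'
      rw [h, h, h] at h1
      rw [h1, h2]; ring)
    (by
      intro c v w
      have h (z) : Function.update ![v, w] 1 z = ![v, z] := by ext i; fin_cases i <;> rfl
      have h1 := (ϖ x).map_update_smul ![v, w] 1 c w
      have h2 := (η x).vecCons_smul ![] c w
      rw [h, h] at h1
      rw [h1, h2]; simp only [smul_eq_mul]; ring)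

namespace LieGroupoid

variable {m n : ℕ} {M G : Type*}
  [TopologicalSpace M] [ChartedSpace (EuclideanSpace ℝ (Fin m)) M] [IsManifold (𝓡 m) ∞ M]
  [TopologicalSpace G] [ChartedSpace (EuclideanSpace ℝ (Fin n)) G] [IsManifold (𝓡 n) ∞ G]
  (𝒢 : LieGroupoid m n M G)

/-- The complex `0 → A_x → T_x M → 0 → 0`, with the anchor as its first differential. -/
def tangentComplex (x : M) : CochainComplex (ModuleCat.{0} ℝ) ℕ :=
  ThreeTerm.complex (𝒢.anchor x) (0 : TangentSpace (𝓡 m) x →ₗ[ℝ] PUnit.{1}) (LinearMap.zero_comp _)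

/-- The complex `0 → 0 → T_x^* M → A_x^* → 0`, with the dual of the anchor as its second
differential. -/
def cotangentComplex (x : M) : CochainComplex (ModuleCat.{0} ℝ) ℕ :=
  ThreeTerm.complex (0 : PUnit.{1} →ₗ[ℝ] Module.Dual ℝ (TangentSpace (𝓡 m) x))
    (𝒢.anchor x).dualMap (LinearMap.comp_zero _)

/-- A basic form is unchanged when vectors `a_i ∈ T_{1_x} G` are mapped to `T_x M` by `dt` or by
`ds`. -/
theorem IsBasic.apply_unit {k : ℕ} {α : FormField m k M} (hα : 𝒢.IsBasic α) (x : M)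
    (a : Fin k → TangentSpace (𝓡 n) (𝒢.unit x)) :
    α x (fun i => 𝒢.dtgtUnit x (a i)) =
      α x (fun i => (mfderiv (𝓡 n) (𝓡 m) 𝒢.src (𝒢.unit x) (a i) : EuclideanSpace ℝ (Fin m))) := by
  have key (y z : M) (h : y = z) (b : Fin k → EuclideanSpace ℝ (Fin m)) :
      (α y : EuclideanSpace ℝ (Fin m) [⋀^Fin k]→L[ℝ] ℝ) b =
        (α z : EuclideanSpace ℝ (Fin m) [⋀^Fin k]→L[ℝ] ℝ) b := by rw [h]
  have h := congrArg (fun β => β a) (congrFun hα (𝒢.unit x))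
  refine (key _ _ (𝒢.tgt_unit x).symm _).trans (Eq.trans h (key _ _ (𝒢.src_unit x) _))

/-- `dt` and `ds` are left inverse to `du` at the unit `1_x`. -/
theorem mfderiv_unit (x : M) (v : TangentSpace (𝓡 m) x) :
    𝒢.dtgtUnit x (mfderiv (𝓡 m) (𝓡 n) 𝒢.unit x v) = v ∧
    (mfderiv (𝓡 n) (𝓡 m) 𝒢.src (𝒢.unit x) (mfderiv (𝓡 m) (𝓡 n) 𝒢.unit x v) :
      EuclideanSpace ℝ (Fin m)) = v := by
  have hu := (𝒢.smooth_unit x).mdifferentiableAt (by simp)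
  have ht := (𝒢.submersion_tgt.contMDiff (𝒢.unit x)).mdifferentiableAt (by simp)
  have hs := (𝒢.submersion_src.contMDiff (𝒢.unit x)).mdifferentiableAt (by simp)
  constructor
  · have h := mfderiv_comp_apply x ht hu v
    rw [show 𝒢.tgt ∘ 𝒢.unit = id from funext 𝒢.tgt_unit, mfderiv_id] at h
    exact h.symm
  · have h := mfderiv_comp_apply x hs hu v
    rw [show 𝒢.src ∘ 𝒢.unit = id from funext 𝒢.src_unit, mfderiv_id] at h
    exact h.symm

/-- For basic forms, `♭ ∘ ρ = 0`. -/
theorem lichnerowicz_comp_anchor {ϖ : FormField m 2 M} {η : FormField m 1 M}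
    (hϖ : 𝒢.IsBasic ϖ) (hη : 𝒢.IsBasic η) (x : M) :
    lichnerowicz ϖ η x ∘ₗ 𝒢.anchor x = 0 := by
  ext ⟨a, ha⟩ v
  obtain ⟨h1, h2⟩ := 𝒢.mfderiv_unit x v
  set b := mfderiv (𝓡 m) (𝓡 n) 𝒢.unit x v
  have ha' : (mfderiv (𝓡 n) (𝓡 m) 𝒢.src (𝒢.unit x) a : EuclideanSpace ℝ (Fin m)) = 0 := ha
  have e1 := hϖ.apply_unit 𝒢 x ![a, b]
  have e2 := hη.apply_unit 𝒢 x ![a]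
  have e3 := (ϖ x).map_coord_zero (m := fun i => (mfderiv (𝓡 n) (𝓡 m) 𝒢.src (𝒢.unit x)
    (![a, b] i) : EuclideanSpace ℝ (Fin m))) 0 ha'
  have e4 := (η x).map_coord_zero (m := fun i => (mfderiv (𝓡 n) (𝓡 m) 𝒢.src (𝒢.unit x)
    (![a] i) : EuclideanSpace ℝ (Fin m))) 0 ha'
  have f1 : (fun i => 𝒢.dtgtUnit x (![a, b] i)) = ![𝒢.dtgtUnit x a, v] := by
    ext1 i; fin_cases i
    · rfl
    · exact h1
  have f2 : (fun i => 𝒢.dtgtUnit x (![a] i)) = ![𝒢.dtgtUnit x a] := by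
    ext1 i; fin_cases i; rfl
  rw [f1] at e1
  rw [f2] at e2
  change ϖ x ![𝒢.dtgtUnit x a, v] + η x ![𝒢.dtgtUnit x a] * η x ![v] = 0
  rw [e1.trans e3, e2.trans e4, zero_mul, add_zero]

/-- For basic forms, `ρ^* ∘ ♭ = 0`. -/
theorem dual_anchor_comp_lichnerowicz {ϖ : FormField m 2 M} {η : FormField m 1 M}
    (hϖ : 𝒢.IsBasic ϖ) (hη : 𝒢.IsBasic η) (x : M) :
    (𝒢.anchor x).dualMap ∘ₗ lichnerowicz ϖ η x = 0 := by
  ext v a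
  have h := LinearMap.congr_fun (LinearMap.congr_fun (𝒢.lichnerowicz_comp_anchor hϖ hη x) a) v
  change ϖ x ![𝒢.anchor x a, v] + η x ![𝒢.anchor x a] * η x ![v] = 0 at h
  have h' := LinearMap.congr_fun
    (LinearMap.congr_fun (𝒢.lichnerowicz_comp_anchor (ϖ := 0) rfl hη x) a) v
  change 0 + η x ![𝒢.anchor x a] * η x ![v] = 0 at h'
  have hs := (ϖ x).map_swap ![𝒢.anchor x a, v] (i := 0) (j := 1) (by decide)
  have e : ![𝒢.anchor x a, v] ∘ Equiv.swap (0 : Fin 2) 1 = ![v, 𝒢.anchor x a] := by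
    ext1 i; fin_cases i <;> rfl
  change ϖ x (![𝒢.anchor x a, v] ∘ Equiv.swap (0 : Fin 2) 1) = -(ϖ x ![𝒢.anchor x a, v]) at hs
  rw [e] at hs
  change ϖ x ![v, 𝒢.anchor x a] + η x ![v] * η x ![𝒢.anchor x a] = 0
  rw [hs]
  linarith

/-- The Lichnerowicz cochain map of a pair of basic forms `(ω, η)` at the point `x`:
```
  0 → A_x →    T_x M   →   0   → 0
       ↓         ↓ ♭       ↓
  0 →  0  →   T_x^* M  → A_x^* → 0
```
-/
def lichnerowiczMap {ϖ : FormField m 2 M} {η : FormField m 1 M}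
    (hϖ : 𝒢.IsBasic ϖ) (hη : 𝒢.IsBasic η) (x : M) :
    𝒢.tangentComplex x ⟶ 𝒢.cotangentComplex x :=
  ThreeTerm.map 0 (lichnerowicz ϖ η x) 0
    (by rw [𝒢.lichnerowicz_comp_anchor hϖ hη x, LinearMap.comp_zero])
    (by rw [𝒢.dual_anchor_comp_lichnerowicz hϖ hη x, LinearMap.zero_comp])

/-- The `0`-shifted cosymplectic structures on `G ⇉ M`: pairs of closed basic forms `(ω, η)`,
with `η` nowhere vanishing, whose Lichnerowicz cochain map is a quasi-isomorphism at all points. -/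
structure IsZeroShiftedCosymplectic (ϖ : FormField m 2 M) (η : FormField m 1 M) : Prop where
  smooth_two : ϖ.IsSmooth
  smooth_one : η.IsSmooth
  closed_two : ϖ.IsClosed
  closed_one : η.IsClosed
  basic_two : 𝒢.IsBasic ϖ
  basic_one : 𝒢.IsBasic η
  nonvanishing : ∀ x, η x ≠ 0
  quasiIso : ∀ x, QuasiIso (𝒢.lichnerowiczMap basic_two basic_one x)

/-- The set of `0`-shifted cosymplectic structures on `G ⇉ M`. -/
def zeroShiftedCosymplectic : Set (FormField m 2 M × FormField m 1 M) :=
  {p | 𝒢.IsZeroShiftedCosymplectic p.1 p.2}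

/-! ### Morphisms and Morita maps -/

variable {m' n' : ℕ} {M' G' : Type*}
  [TopologicalSpace M'] [ChartedSpace (EuclideanSpace ℝ (Fin m')) M'] [IsManifold (𝓡 m') ∞ M']
  [TopologicalSpace G'] [ChartedSpace (EuclideanSpace ℝ (Fin n')) G'] [IsManifold (𝓡 n') ∞ G']

/-- A morphism of Lie groupoids from `G' ⇉ M'` to `G ⇉ M`. -/
structure Hom (𝒢' : LieGroupoid m' n' M' G') (𝒢 : LieGroupoid m n M G) where
  onObj : M' → M
  onArr : G' → G
  smooth_onObj : ContMDiff (𝓡 m') (𝓡 m) ∞ onObj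
  smooth_onArr : ContMDiff (𝓡 n') (𝓡 n) ∞ onArr
  src_onArr : ∀ g, 𝒢.src (onArr g) = onObj (𝒢'.src g)
  tgt_onArr : ∀ g, 𝒢.tgt (onArr g) = onObj (𝒢'.tgt g)
  onArr_unit : ∀ x, onArr (𝒢'.unit x) = 𝒢.unit (onObj x)
  onArr_mul : ∀ g h, 𝒢'.src g = 𝒢'.tgt h → onArr (𝒢'.mul g h) = 𝒢.mul (onArr g) (onArr h)

namespace Hom

variable {𝒢' : LieGroupoid m' n' M' G'} {𝒢 : LieGroupoid m n M G}

/-- The fibre product `(M' × M') ×_{M × M} G` of `φ × φ` and `(s, t)`. -/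
def fibreProduct (φ : Hom 𝒢' 𝒢) : Set ((M' × M') × G) :=
  {p | 𝒢.src p.2 = φ.onObj p.1.1 ∧ 𝒢.tgt p.2 = φ.onObj p.1.2}

/-- The comparison map `(s', t', φ) : G' → (M' × M') × G`. -/
def comparison (φ : Hom 𝒢' 𝒢) (g : G') : (M' × M') × G :=
  ((𝒢'.src g, 𝒢'.tgt g), φ.onArr g)

/-- `φ` is fully faithful if `(s', t', φ)` is a diffeomorphism from `G'` onto the fibre product
`(M' × M') ×_{M × M} G`, that is, if it (is smooth and) has an inverse that is smooth on the
fibre product. -/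
def IsFullyFaithful (φ : Hom 𝒢' 𝒢) : Prop :=
  ∃ ψ : (M' × M') × G → G',
    ContMDiffOn (((𝓡 m').prod (𝓡 m')).prod (𝓡 n)) (𝓡 n') ∞ ψ φ.fibreProduct ∧
    (∀ g, ψ (φ.comparison g) = g) ∧ ∀ p ∈ φ.fibreProduct, φ.comparison (ψ p) = p

/-- `φ` is essentially surjective if the map `(g, y) ↦ t g` from the fibre product
`G ×_M M' = {(g, y) | s g = φ y}` to `M` is a surjective submersion. As `s` is a submersion, the
tangent space of `G ×_M M'` at `(g, y)` consists of the `(a, b)` with `ds a = dφ b`. -/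
structure IsEssentiallySurjective (φ : Hom 𝒢' 𝒢) : Prop where
  surjective : ∀ x, ∃ g y, 𝒢.src g = φ.onObj y ∧ 𝒢.tgt g = x
  submersion : ∀ g y, 𝒢.src g = φ.onObj y → ∀ v : TangentSpace (𝓡 m) (𝒢.tgt g),
    ∃ (a : TangentSpace (𝓡 n) g) (b : TangentSpace (𝓡 m') y),
      (mfderiv (𝓡 n) (𝓡 m) 𝒢.src g a : EuclideanSpace ℝ (Fin m)) =
        mfderiv (𝓡 m') (𝓡 m) φ.onObj y b ∧
      mfderiv (𝓡 n) (𝓡 m) 𝒢.tgt g a = v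

/-- A Morita map is a fully faithful and essentially surjective morphism of Lie groupoids. -/
structure IsMorita (φ : Hom 𝒢' 𝒢) : Prop where
  fullyFaithful : φ.IsFullyFaithful
  essentiallySurjective : φ.IsEssentiallySurjective

/-- The pullback `φ^* α` of a form on the objects of the target groupoid. -/
def pullback {k : ℕ} (φ : Hom 𝒢' 𝒢) (α : FormField m k M) : FormField m' k M' :=
  FormField.pullback φ.onObj α

/-- The pullback of a basic form under a morphism of Lie groupoids is basic. -/
theorem isBasic_pullback {k : ℕ} (φ : Hom 𝒢' 𝒢) {α : FormField m k M} (hα : 𝒢.IsBasic α) :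
    𝒢'.IsBasic (φ.pullback α) := by
  have comp (f : G' → M') (f' : G → M) (hf : ContMDiff (𝓡 n') (𝓡 m') ∞ f)
      (hf' : ContMDiff (𝓡 n) (𝓡 m) ∞ f') (h : ∀ g, f' (φ.onArr g) = φ.onObj (f g)) :
      (φ.pullback α).pullback (n := n') f =
        (α.pullback (n := n) f').pullback (n := n') φ.onArr := by
    rw [pullback, FormField.pullback_comp φ.smooth_onObj hf,
      FormField.pullback_comp hf' φ.smooth_onArr,
      show f' ∘ φ.onArr = φ.onObj ∘ f from funext h]
  have h := congrArg
    (fun β : FormField n k G => β.pullback (n := n') φ.onArr) hα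
  rw [IsBasic, comp 𝒢'.tgt 𝒢.tgt 𝒢'.submersion_tgt.contMDiff 𝒢.submersion_tgt.contMDiff φ.tgt_onArr,
    comp 𝒢'.src 𝒢.src 𝒢'.submersion_src.contMDiff 𝒢.submersion_src.contMDiff φ.src_onArr]
  exact h

end Hom

end LieGroupoid

end

/-!
A tangent vector `a` at an arrow `g` is used only through the pair `(ds a, dt a)`; these pairs form
the relation `arrowTangent g` between tangent vectors at the source and at the target of `g`. The
relations can be composed and inverted like arrows (`mem_arrowTangent_mul`, `mem_arrowTangent_inv`),
and all data of the theorem are read off from them: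

* the image of the anchor at `x` consists of the `v` such that `(0, v)` belongs to the relation of
  the unit at `x`, and the anchor is injective if and only if this relation has the dimension of the
  manifold of arrows;
* a form is basic if and only if it takes the same values on both sides of each relation
  (`isBasic_iff`).

The Lichnerowicz map is a quasi-isomorphism at `x` if and only if the anchor is injective at `x` and
`ker ♭_x` is contained in its image (`quasiIso_lichnerowiczMap_iff`); the rest is a dimension count.
Transport along an arrow then yields the invariance along orbits. For a Morita map, the relations of
the source groupoid are the preimages of those of the target groupoid
(`IsMorita.mem_arrowTangent_iff`), and the derivative on objects is surjective up to the image of the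
anchor; this compares the two Lichnerowicz maps.

A basic form `α'` on `M'` descends to `M`: its value on vectors at `x` is computed by choosing an
arrow from some `φ y` to `x`, transporting the vectors back to `φ y`, and lifting them to `y`. Two
choices differ by a tangent vector of `G'`, hence do not matter (`IsMorita.atPoint_eq`). Choosing the
arrow and `y` by a local section of the submersion `G ×_M M' → M` shows that the descended form is
locally a pullback of `α'` along a smooth map, so that it is smooth and closed if `α'` is.

Multiplication and the inverse of the comparison map of a Morita map are smooth only on subsets given
by an equation `f₁ = f₂`. They are differentiated along curves in these subsets, which the inverse
function theorem provides where the difference of the derivatives of `f₁` and `f₂` is surjective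
(`exists_curve_of_equalizer`).
-/

noncomputable section

/-! ### Quasi-isomorphisms of three-term complexes -/

/-- An element-wise criterion for a morphism of short complexes of modules to induce an isomorphism
in homology. -/
theorem ShortComplex.moduleCat_quasiIso_iff {R : Type*} [Ring R]
    {S₁ S₂ : ShortComplex (ModuleCat.{0} R)} (φ : S₁ ⟶ S₂) :
    ShortComplex.QuasiIso φ ↔
      (∀ x : S₁.X₂, S₁.g x = 0 → (∃ w, S₂.f w = φ.τ₂ x) → ∃ z, S₁.f z = x) ∧
      ∀ y : S₂.X₂, S₂.g y = 0 → ∃ x : S₁.X₂, S₁.g x = 0 ∧ ∃ w, S₂.f w = y - φ.τ₂ x := by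
  have surj (S : ShortComplex (ModuleCat.{0} R)) :
      Function.Surjective S.moduleCatLeftHomologyData.π := Submodule.mkQ_surjective _
  have lift (S : ShortComplex (ModuleCat.{0} R)) (x : S.X₂) (hx : S.g x = 0) :
      ∃ k : S.moduleCatLeftHomologyData.K, S.moduleCatLeftHomologyData.i k = x := ⟨⟨x, hx⟩, rfl⟩
  have cycle (S : ShortComplex (ModuleCat.{0} R)) (k : S.moduleCatLeftHomologyData.K) :
      S.g (S.moduleCatLeftHomologyData.i k) = 0 := k.2
  have zero (S : ShortComplex (ModuleCat.{0} R)) (k : S.moduleCatLeftHomologyData.K) :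
      S.moduleCatLeftHomologyData.π k = 0 ↔ ∃ z, S.f z = S.moduleCatLeftHomologyData.i k := by
    refine (Submodule.Quotient.mk_eq_zero _).trans ⟨?_, ?_⟩
    · rintro ⟨z, hz⟩
      exact ⟨z, congrArg Subtype.val hz⟩
    · rintro ⟨z, hz⟩
      exact ⟨z, Subtype.ext hz⟩
  have surj₁ := surj S₁
  have surj₂ := surj S₂
  have zero₁ := zero S₁
  have zero₂ := zero S₂
  have lift₁ := lift S₁
  have lift₂ := lift S₂
  have cycle₁ := cycle S₁
  have cycle₂ := cycle S₂
  clear surj zero lift cycle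
  generalize S₁.moduleCatLeftHomologyData = h₁ at *
  generalize S₂.moduleCatLeftHomologyData = h₂ at *
  let γ : ShortComplex.LeftHomologyMapData φ h₁ h₂ := default
  have hK (x : h₁.K) : h₂.i (γ.φK x) = φ.τ₂ (h₁.i x) := congr($(γ.commi) x)
  have hH (x : h₁.K) : γ.φH (h₁.π x) = h₂.π (γ.φK x) := by
    rw [← ConcreteCategory.comp_apply, ← ConcreteCategory.comp_apply, γ.commπ]
  rw [γ.quasiIso_iff, ConcreteCategory.isIso_iff_bijective]
  refine and_congr ?_ ?_
  · rw [injective_iff_map_eq_zero]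
    constructor
    · intro h x hx ⟨w, hw⟩
      obtain ⟨k, rfl⟩ := lift₁ x hx
      exact (zero₁ k).1 (h _ (by rw [hH, zero₂, hK]; exact ⟨w, hw⟩))
    · intro h a ha
      obtain ⟨k, rfl⟩ := surj₁ a
      rw [hH, zero₂, hK] at ha
      exact (zero₁ k).2 (h _ (cycle₁ k) ha)
  · constructor
    · intro h y hy
      obtain ⟨l, rfl⟩ := lift₂ y hy
      obtain ⟨a, ha⟩ := h (h₂.π l)
      obtain ⟨k, rfl⟩ := surj₁ a
      refine ⟨h₁.i k, cycle₁ k, ?_⟩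
      rwa [hH, eq_comm, ← sub_eq_zero, ← map_sub, zero₂, map_sub, hK] at ha
    · intro h a
      obtain ⟨l, rfl⟩ := surj₂ a
      obtain ⟨x, hx, hw⟩ := h _ (cycle₂ l)
      obtain ⟨k, rfl⟩ := lift₁ x hx
      refine ⟨h₁.π k, ?_⟩
      rwa [hH, eq_comm, ← sub_eq_zero, ← map_sub, zero₂, map_sub, hK]

/-- The element-wise criterion for a morphism of complexes of modules to be a quasi-isomorphism in
the middle one of three consecutive degrees `i`, `j`, `k`. -/
theorem HomologicalComplex.moduleCat_quasiIsoAt_iff {R : Type*} [Ring R] {ι : Type*}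
    {c : ComplexShape ι} {K L : HomologicalComplex (ModuleCat.{0} R) c} (φ : K ⟶ L) (i j k : ι)
    (hi : c.prev j = i) (hk : c.next j = k) :
    QuasiIsoAt φ j ↔
      (∀ x : K.X j, K.d j k x = 0 → (∃ w, L.d i j w = φ.f j x) → ∃ z, K.d i j z = x) ∧
      ∀ y : L.X j, L.d j k y = 0 → ∃ x : K.X j, K.d j k x = 0 ∧ ∃ w, L.d i j w = y - φ.f j x := by
  rw [quasiIsoAt_iff' _ i j k hi hk, ShortComplex.moduleCat_quasiIso_iff]
  rfl

namespace ThreeTerm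

variable {V₀ V₁ V₂ W₀ W₁ W₂ : Type}
  [AddCommGroup V₀] [Module ℝ V₀] [AddCommGroup V₁] [Module ℝ V₁]
  [AddCommGroup V₂] [Module ℝ V₂] [AddCommGroup W₀] [Module ℝ W₀]
  [AddCommGroup W₁] [Module ℝ W₁] [AddCommGroup W₂] [Module ℝ W₂]
  {f : V₀ →ₗ[ℝ] V₁} {g : V₁ →ₗ[ℝ] V₂} {h : g ∘ₗ f = 0}
  {f' : W₀ →ₗ[ℝ] W₁} {g' : W₁ →ₗ[ℝ] W₂} {h' : g' ∘ₗ f' = 0}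
  {a : V₀ →ₗ[ℝ] W₀} {b : V₁ →ₗ[ℝ] W₁} {c : V₂ →ₗ[ℝ] W₂}
  {hab : f' ∘ₗ a = b ∘ₗ f} {hbc : g' ∘ₗ b = c ∘ₗ g}

theorem complex_d (i : ℕ) : (complex f g h).d i (i + 1) = diff f g i := CochainComplex.of_d _ _ _

/-- A ladder of three-term complexes is a quasi-isomorphism if and only if it induces injective and
surjective maps in cohomology in the degrees `0`, `1` and `2`. -/
theorem quasiIso_map_iff :
    QuasiIso (map (h := h) (h' := h') a b c hab hbc) ↔
      ((∀ x, f x = 0 → a x = 0 → x = 0) ∧ ∀ y, f' y = 0 → ∃ x, f x = 0 ∧ a x = y) ∧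
      ((∀ x, g x = 0 → (∃ w, f' w = b x) → ∃ z, f z = x) ∧
        ∀ y, g' y = 0 → ∃ x, g x = 0 ∧ ∃ w, f' w = y - b x) ∧
      (∀ x, (∃ w, g' w = c x) → ∃ z, g z = x) ∧ ∀ y, ∃ x, ∃ w, g' w = y - c x := by
  have h₀ : QuasiIsoAt (map (h := h) (h' := h') a b c hab hbc) 0 ↔
      (∀ x, f x = 0 → a x = 0 → x = 0) ∧ ∀ y, f' y = 0 → ∃ x, f x = 0 ∧ a x = y := by
    rw [HomologicalComplex.moduleCat_quasiIsoAt_iff _ 0 0 1 (by simp) (by simp),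
      complex_d, complex_d, HomologicalComplex.shape _ 0 0 (by simp),
      HomologicalComplex.shape _ 0 0 (by simp)]
    change (∀ x : V₀, f x = 0 → (∃ _ : W₀, (0 : W₀) = a x) → ∃ _ : V₀, (0 : V₀) = x) ∧
      (∀ y : W₀, f' y = 0 → ∃ x : V₀, f x = 0 ∧ ∃ _ : W₀, (0 : W₀) = y - a x) ↔ _
    simp only [exists_const, eq_comm (a := (0 : V₀)), eq_comm (a := (0 : W₀)), sub_eq_zero,
      eq_comm (b := a _)]
  have h₁ : QuasiIsoAt (map (h := h) (h' := h') a b c hab hbc) 1 ↔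
      (∀ x, g x = 0 → (∃ w, f' w = b x) → ∃ z, f z = x) ∧
        ∀ y, g' y = 0 → ∃ x, g x = 0 ∧ ∃ w, f' w = y - b x := by
    rw [HomologicalComplex.moduleCat_quasiIsoAt_iff _ 0 1 2 (by simp) (by simp),
      complex_d 1, complex_d 1, complex_d 0, complex_d 0]
    rfl
  have h₂ : QuasiIsoAt (map (h := h) (h' := h') a b c hab hbc) 2 ↔
      (∀ x, (∃ w, g' w = c x) → ∃ z, g z = x) ∧ ∀ y, ∃ x, ∃ w, g' w = y - c x := by
    rw [HomologicalComplex.moduleCat_quasiIsoAt_iff _ 1 2 3 (by simp) (by simp),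
      complex_d 2, complex_d 2, complex_d 1, complex_d 1]
    change (∀ x : V₂, PUnit.unit = PUnit.unit → (∃ w, g' w = c x) → ∃ z, g z = x) ∧
      (∀ y : W₂, PUnit.unit = PUnit.unit →
        ∃ x : V₂, PUnit.unit = PUnit.unit ∧ ∃ w, g' w = y - c x) ↔ _
    simp only [true_and, true_imp_iff]
  have h₃ (i : ℕ) : QuasiIsoAt (map (h := h) (h' := h') a b c hab hbc) (i + 3) := by
    rw [HomologicalComplex.moduleCat_quasiIsoAt_iff _ (i + 2) (i + 3) (i + 4) (by simp) (by simp)]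
    exact ⟨fun x _ _ => ⟨0, Subsingleton.elim (α := PUnit) _ _⟩,
      fun y _ => ⟨0, map_zero _, 0, Subsingleton.elim (α := PUnit) _ _⟩⟩
  rw [quasiIso_iff, ← h₀, ← h₁, ← h₂]
  refine ⟨fun H => ⟨H 0, H 1, H 2⟩, fun H i => ?_⟩
  match i with
  | 0 => exact H.1
  | 1 => exact H.2.1
  | 2 => exact H.2.2
  | i + 3 => exact h₃ i

end ThreeTerm

namespace LieGroupoid

variable {m n : ℕ} {M G : Type*}
  [TopologicalSpace M] [ChartedSpace (EuclideanSpace ℝ (Fin m)) M] [IsManifold (𝓡 m) ∞ M]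
  [TopologicalSpace G] [ChartedSpace (EuclideanSpace ℝ (Fin n)) G] [IsManifold (𝓡 n) ∞ G]
  (𝒢 : LieGroupoid m n M G)

/-- The Lichnerowicz map is a quasi-isomorphism at `x` if and only if the anchor at `x` is injective
and the kernel of `♭_x` is the image of the anchor. The surjectivity in cohomology in degree `1`
then holds by counting dimensions, since `♭_x` maps into the annihilator of the image of the
anchor. -/
theorem quasiIso_lichnerowiczMap_iff {ϖ : FormField m 2 M} {η : FormField m 1 M}
    (hϖ : 𝒢.IsBasic ϖ) (hη : 𝒢.IsBasic η) (x : M) :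
    QuasiIso (𝒢.lichnerowiczMap hϖ hη x) ↔
      (∀ a, 𝒢.anchor x a = 0 → a = 0) ∧
        ∀ v, lichnerowicz ϖ η x v = 0 → ∃ a, 𝒢.anchor x a = v := by
  refine ThreeTerm.quasiIso_map_iff.trans ?_
  constructor
  · rintro ⟨⟨h₀, -⟩, ⟨h₁, -⟩, -⟩
    exact ⟨fun a ha => h₀ a ha rfl, fun v hv => h₁ v rfl ⟨0, hv.symm⟩⟩
  · rintro ⟨h₀, h₁⟩
    refine ⟨⟨fun a ha _ => h₀ a ha, fun y _ => ⟨0, map_zero _, rfl⟩⟩,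
      ⟨fun v _ ⟨w, hw⟩ => h₁ v hw.symm, fun y hy => ?_⟩, fun _ _ => ⟨0, rfl⟩, fun y => ⟨0, ?_⟩⟩
    · have : FiniteDimensional ℝ (TangentSpace (𝓡 m) x) :=
        inferInstanceAs (FiniteDimensional ℝ (EuclideanSpace ℝ (Fin m)))
      have hker : LinearMap.ker (lichnerowicz ϖ η x) = LinearMap.range (𝒢.anchor x) := by
        refine le_antisymm (fun v hv => h₁ v hv) ?_
        rw [LinearMap.range_le_ker_iff]
        exact 𝒢.lichnerowicz_comp_anchor hϖ hη x
      have hle : LinearMap.range (lichnerowicz ϖ η x) ≤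
          (LinearMap.range (𝒢.anchor x)).dualAnnihilator := by
        rw [← LinearMap.ker_dualMap_eq_dualAnnihilator_range, LinearMap.range_le_ker_iff]
        exact 𝒢.dual_anchor_comp_lichnerowicz hϖ hη x
      have hd := Subspace.finrank_add_finrank_dualAnnihilator_eq (LinearMap.range (𝒢.anchor x))
      have hr := LinearMap.finrank_range_add_finrank_ker (lichnerowicz ϖ η x)
      rw [hker] at hr
      have heq := Submodule.eq_of_le_of_finrank_eq hle (by omega)
      have hy' : y ∈ LinearMap.range (lichnerowicz ϖ η x) := by
        rw [heq, ← LinearMap.ker_dualMap_eq_dualAnnihilator_range]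
        exact hy
      obtain ⟨v, rfl⟩ := hy'
      exact ⟨v, rfl, 0, by rw [map_zero, sub_self]⟩
    · rw [map_zero, sub_zero]
      refine LinearMap.dualMap_surjective_iff.2 ?_ y
      exact (injective_iff_map_eq_zero _).2 h₀

end LieGroupoid

/-! ### Derivatives as maps between model spaces -/

section ModelDeriv

open Filter Topology

variable {E H X : Type*} [NormedAddCommGroup E] [NormedSpace ℝ E] [TopologicalSpace H]
  [TopologicalSpace X] [ChartedSpace H X] (I : ModelWithCorners ℝ E H)
  {F K Y : Type*} [NormedAddCommGroup F] [NormedSpace ℝ F] [TopologicalSpace K]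
  [TopologicalSpace Y] [ChartedSpace K Y] (J : ModelWithCorners ℝ F K)
  {E' H' Z : Type*} [NormedAddCommGroup E'] [NormedSpace ℝ E'] [TopologicalSpace H']
  [TopologicalSpace Z] [ChartedSpace H' Z] (I' : ModelWithCorners ℝ E' H')

/-- The derivative of a map between manifolds, with all tangent spaces identified with the model
vector spaces. As its type does not mention base points, it can be rewritten along equations
between points. -/
def modelDeriv (f : X → Y) (x : X) : E →L[ℝ] F := mfderiv I J f x

variable {I J I'}

theorem modelDeriv_congr {f g : X → Y} {x : X} (h : f =ᶠ[𝓝 x] g) :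
    modelDeriv I J f x = modelDeriv I J g x := h.mfderiv_eq

theorem modelDeriv_comp {g : Y → Z} {f : X → Y} (x : X) (hg : MDifferentiableAt J I' g (f x))
    (hf : MDifferentiableAt I J f x) :
    modelDeriv I I' (fun z => g (f z)) x =
      (modelDeriv J I' g (f x)).comp (modelDeriv I J f x) := mfderiv_comp x hg hf

theorem modelDeriv_comp_apply {g : Y → Z} {f : X → Y} (x : X)
    (hg : MDifferentiableAt J I' g (f x)) (hf : MDifferentiableAt I J f x) (v : E) :
    modelDeriv I I' (fun z => g (f z)) x v = modelDeriv J I' g (f x) (modelDeriv I J f x v) :=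
  congr($(modelDeriv_comp x hg hf) v)

theorem modelDeriv_id (x : X) : modelDeriv I I (fun y : X => y) x = .id ℝ E := mfderiv_id

theorem modelDeriv_prodMk {f : X → Y} {g : X → Z} {x : X} (hf : MDifferentiableAt I J f x)
    (hg : MDifferentiableAt I I' g x) :
    modelDeriv I (J.prod I') (fun y => (f y, g y)) x =
      (modelDeriv I J f x).prod (modelDeriv I I' g x) :=
  (hf.hasMFDerivAt.prodMk hg.hasMFDerivAt).mfderiv

theorem modelDeriv_fst (p : X × Y) :
    modelDeriv (I.prod J) I (fun q : X × Y => q.1) p = .fst ℝ E F := mfderiv_fst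

theorem modelDeriv_snd (p : X × Y) :
    modelDeriv (I.prod J) J (fun q : X × Y => q.2) p = .snd ℝ E F := mfderiv_snd

theorem modelDeriv_eq_fderiv {f : E → F} {x : E} :
    modelDeriv 𝓘(ℝ, E) 𝓘(ℝ, F) f x = fderiv ℝ f x := mfderiv_eq_fderiv

theorem modelDeriv_sub {f g : X → F} {x : X} (hf : MDifferentiableAt I 𝓘(ℝ, F) f x)
    (hg : MDifferentiableAt I 𝓘(ℝ, F) g x) :
    modelDeriv I 𝓘(ℝ, F) (fun y => f y - g y) x =
      modelDeriv I 𝓘(ℝ, F) f x - modelDeriv I 𝓘(ℝ, F) g x :=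
  (hf.hasMFDerivAt.sub hg.hasMFDerivAt).mfderiv

theorem modelDeriv_extChartAt_self [IsManifold I 1 X] (x : X) :
    modelDeriv I 𝓘(ℝ, E) (extChartAt I x) x = .id ℝ E := mfderiv_extChartAt_self

/-- A map that is differentiable within `S` can be differentiated along curves that stay in `S`. -/
theorem MDifferentiableWithinAt.comp_curve {ψ : X → Y} {S : Set X} {c : ℝ → X}
    (hψ : MDifferentiableWithinAt I J ψ S (c 0)) (hc : MDifferentiableAt 𝓘(ℝ, ℝ) I c 0)
    (hS : ∀ᶠ t in 𝓝 0, c t ∈ S) : MDifferentiableAt 𝓘(ℝ, ℝ) J (fun t => ψ (c t)) 0 :=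
  (hψ.comp (s := c ⁻¹' S) 0 hc.mdifferentiableWithinAt fun _ h => h).mdifferentiableAt hS

variable [I.Boundaryless]

theorem contMDiffAt_extChartAt_symm_of_mem [IsManifold I ∞ X] {x : X} {y : E}
    (hy : y ∈ (extChartAt I x).target) : ContMDiffAt 𝓘(ℝ, E) I ∞ (extChartAt I x).symm y :=
  (contMDiffOn_extChartAt_symm x).contMDiffAt ((isOpen_extChartAt_target x).mem_nhds hy)

theorem modelDeriv_extChartAt_symm_comp [IsManifold I ∞ X] {x z : X}
    (hz : z ∈ (extChartAt I x).source) :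
    (modelDeriv 𝓘(ℝ, E) I (extChartAt I x).symm (extChartAt I x z)).comp
      (modelDeriv I 𝓘(ℝ, E) (extChartAt I x) z) = .id ℝ E := by
  have hz' : z ∈ (chartAt H x).source := by rwa [extChartAt_source] at hz
  have h₁ : MDifferentiableAt 𝓘(ℝ, E) I (extChartAt I x).symm (extChartAt I x z) :=
    (contMDiffAt_extChartAt_symm_of_mem ((extChartAt I x).map_source hz)).mdifferentiableAt
      (by simp)
  have h₂ : MDifferentiableAt I 𝓘(ℝ, E) (extChartAt I x) z :=
    (contMDiffAt_extChartAt' (n := ∞) hz').mdifferentiableAt (by simp)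
  rw [← modelDeriv_comp z h₁ h₂, ← modelDeriv_id (I := I) z]
  refine modelDeriv_congr ?_
  filter_upwards [(isOpen_extChartAt_source x).mem_nhds hz] with y hy
  exact (extChartAt I x).left_inv hy

/-- The derivative of a submersion is surjective. -/
theorem Manifold.IsSubmersionAt.modelDeriv_surjective [J.Boundaryless]
    [IsManifold I ∞ X] [IsManifold J ∞ Y]
    {f : X → Y} {x : X} (h : Manifold.IsSubmersionAt I J ∞ f x) :
    Function.Surjective (modelDeriv I J f x) := by
  set e := h.domChart.extend I with he
  set c := h.codChart.extend J with hc
  have hxe : x ∈ e.source := by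
    rw [he, OpenPartialHomeomorph.extend_source]; exact h.mem_domChart_source
  have hfx : f x ∈ c.source := by
    rw [hc, OpenPartialHomeomorph.extend_source]; exact h.mem_codChart_source
  have hte : IsOpen e.target := OpenPartialHomeomorph.isOpen_extend_target _
  have htc : IsOpen c.target := OpenPartialHomeomorph.isOpen_extend_target _
  have hse : ContMDiffAt 𝓘(ℝ, E) I ∞ e.symm (e x) := by
    have := contMDiffOn_extend_symm (I := I) h.domChart_mem_maximalAtlas
    rw [← OpenPartialHomeomorph.extend_target'] at this
    exact this.contMDiffAt (hte.mem_nhds (e.map_source hxe))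
  have hsc : ContMDiffAt 𝓘(ℝ, F) J ∞ c.symm (c (f x)) := by
    have := contMDiffOn_extend_symm (I := J) h.codChart_mem_maximalAtlas
    rw [← OpenPartialHomeomorph.extend_target'] at this
    exact this.contMDiffAt (htc.mem_nhds (c.map_source hfx))
  have hcf : ContMDiffAt J 𝓘(ℝ, F) ∞ c (f x) :=
    OpenPartialHomeomorph.contMDiffAt_extend h.codChart_mem_maximalAtlas h.mem_codChart_source
  have hf : MDifferentiableAt I J f (e.symm (e x)) := by
    rw [e.left_inv hxe]; exact h.contMDiffAt.mdifferentiableAt (by simp)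
  let L : E →L[ℝ] F :=
    (ContinuousLinearMap.fst ℝ F h.complement).comp (h.equiv : E →L[ℝ] F × h.complement)
  have hval : L (e x) = c (f x) := by
    have := h.writtenInCharts (e.map_source hxe)
    simp only [Function.comp_apply, ← he, ← hc, e.left_inv hxe] at this
    exact this.symm
  -- in the charts, `f` is the composition of a linear surjection and the inverse of a chart
  have key : (fun u => f (e.symm u)) =ᶠ[𝓝 (e x)] fun u => c.symm (L u) := by
    filter_upwards [hte.mem_nhds (e.map_source hxe)] with u hu
    have h1 := h.writtenInCharts hu
    have h2 : f (e.symm u) ∈ c.source := by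
      have := e.map_target hu
      rw [he, OpenPartialHomeomorph.extend_source] at this
      rw [hc, OpenPartialHomeomorph.extend_source]
      exact h.source_subset_preimage_source this
    have h3 : c (f (e.symm u)) = (h.equiv u).1 := h1
    change f (e.symm u) = c.symm (h.equiv u).1
    rw [← h3, c.left_inv h2]
  have hsc' : MDifferentiableAt 𝓘(ℝ, F) J c.symm (L (e x)) := by
    rw [hval]; exact hsc.mdifferentiableAt (by simp)
  have hL : MDifferentiableAt 𝓘(ℝ, E) 𝓘(ℝ, F) L (e x) :=
    L.differentiableAt.mdifferentiableAt
  have h1 := modelDeriv_congr (I := 𝓘(ℝ, E)) (J := J) key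
  rw [modelDeriv_comp _ hf (hse.mdifferentiableAt (by simp)), modelDeriv_comp _ hsc' hL,
    e.left_inv hxe, hval, modelDeriv_eq_fderiv, L.fderiv] at h1
  have h2 : (modelDeriv 𝓘(ℝ, F) J c.symm (c (f x))).comp
      (modelDeriv J 𝓘(ℝ, F) c (f x)) = .id ℝ F := by
    rw [← modelDeriv_comp (f x) (hsc.mdifferentiableAt (by simp))
      (hcf.mdifferentiableAt (by simp)), ← modelDeriv_id (I := J) (f x)]
    refine modelDeriv_congr ?_
    filter_upwards [OpenPartialHomeomorph.extend_source_mem_nhds (I := J) _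
      h.mem_codChart_source] with y hy
    exact c.left_inv hy
  intro v
  refine ⟨modelDeriv 𝓘(ℝ, E) I e.symm (e x)
    (h.equiv.symm (modelDeriv J 𝓘(ℝ, F) c (f x) v, 0)), ?_⟩
  refine (congr($h1 (h.equiv.symm (modelDeriv J 𝓘(ℝ, F) c (f x) v, 0)))).trans ?_
  have h3 : L (h.equiv.symm (modelDeriv J 𝓘(ℝ, F) c (f x) v, 0)) =
      modelDeriv J 𝓘(ℝ, F) c (f x) v := by simp [L]
  rw [ContinuousLinearMap.comp_apply, h3]
  exact congr($h2 v)

theorem modelDeriv_extChartAt_symm_self [IsManifold I ∞ X] (x : X) :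
    modelDeriv 𝓘(ℝ, E) I (extChartAt I x).symm (extChartAt I x x) = .id ℝ E := by
  have : IsManifold I 1 X := IsManifold.of_le (n := ∞) (by simp)
  have h := modelDeriv_extChartAt_symm_comp (mem_extChartAt_source (I := I) x)
  rwa [modelDeriv_extChartAt_self, ContinuousLinearMap.comp_id] at h

variable [FiniteDimensional ℝ F]

/-- A smooth map with surjective derivative at `p` has a smooth section near its value at `p`, by
the inverse function theorem. -/
theorem exists_contMDiffAt_section [IsManifold I ∞ X] [IsManifold J ∞ Y] {f : X → Y} {p : X}
    (hf : ContMDiffAt I J ∞ f p) (hsurj : Function.Surjective (modelDeriv I J f p)) :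
    ∃ σ : Y → X, ContMDiffAt J I ∞ σ (f p) ∧ σ (f p) = p ∧ ∀ᶠ y in 𝓝 (f p), f (σ y) = y := by
  have : IsManifold J 1 Y := IsManifold.of_le (n := ∞) (by simp)
  have : CompleteSpace F := FiniteDimensional.complete ℝ F
  obtain ⟨R₀, hR₀⟩ := LinearMap.exists_rightInverse_of_surjective
    (modelDeriv I J f p : E →ₗ[ℝ] F) (LinearMap.range_eq_top.2 hsurj)
  let R : F →L[ℝ] E := LinearMap.toContinuousLinearMap R₀
  have hR (u : F) : modelDeriv I J f p (R u) = u := congr($hR₀ u)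
  let A : F → X := fun u => (extChartAt I p).symm (extChartAt I p p + R u)
  have hA₀ : A 0 = p := by simp [A]
  have hin : ContMDiffAt 𝓘(ℝ, F) 𝓘(ℝ, E) ∞ (fun u => extChartAt I p p + R u) 0 :=
    (contDiffAt_const.add R.contDiff.contDiffAt).contMDiffAt
  have hsym : ContMDiffAt 𝓘(ℝ, E) I ∞ (extChartAt I p).symm (extChartAt I p p + R 0) := by
    rw [map_zero, add_zero]
    exact contMDiffAt_extChartAt_symm_of_mem (mem_extChartAt_target p)
  have hA' : ContMDiffAt 𝓘(ℝ, F) I ∞ A 0 := hsym.comp 0 hin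
  have hfA : ContMDiffAt I J ∞ f (A 0) := by rwa [hA₀]
  have hc : ContMDiffAt J 𝓘(ℝ, F) ∞ (extChartAt J (f p)) (f (A 0)) := by
    rw [hA₀]; exact contMDiffAt_extChartAt
  let Ψ : F → F := fun u => extChartAt J (f p) (f (A u))
  have hΨ₀ : Ψ 0 = extChartAt J (f p) (f p) := by simp only [Ψ, hA₀]
  have hΨ : ContDiffAt ℝ ∞ Ψ 0 := by
    rw [← contMDiffAt_iff_contDiffAt]
    exact hc.comp 0 (hfA.comp 0 hA')
  have hdΨ : HasFDerivAt Ψ ((ContinuousLinearEquiv.refl ℝ F : F ≃L[ℝ] F) : F →L[ℝ] F) 0 := by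
    have h1 : fderiv ℝ Ψ 0 = .id ℝ F := by
      have hin' : modelDeriv 𝓘(ℝ, F) 𝓘(ℝ, E) (fun u => extChartAt I p p + R u) 0 = R := by
        rw [modelDeriv_eq_fderiv, fderiv_const_add, R.fderiv]
      have hsym' : modelDeriv 𝓘(ℝ, E) I (extChartAt I p).symm (extChartAt I p p + R 0) =
          .id ℝ E := by
        rw [map_zero, add_zero, modelDeriv_extChartAt_symm_self]
      have hA1 : modelDeriv 𝓘(ℝ, F) I A 0 = R := by
        rw [modelDeriv_comp 0 (hsym.mdifferentiableAt (by simp)) (hin.mdifferentiableAt (by simp)),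
          hin', hsym', ContinuousLinearMap.id_comp]
      rw [← modelDeriv_eq_fderiv, modelDeriv_comp (f := fun u => f (A u)) 0
        (hc.mdifferentiableAt (by simp))
          ((hfA.comp 0 hA').mdifferentiableAt (by simp)),
        modelDeriv_comp 0 (hfA.mdifferentiableAt (by simp)) (hA'.mdifferentiableAt (by simp)),
        hA₀, modelDeriv_extChartAt_self, hA1]
      ext u
      exact hR u
    have h2 := (hΨ.differentiableAt (by simp)).hasFDerivAt
    rwa [h1] at h2
  have hl := hΨ.to_localInverse hdΨ (by simp)
  have hl₀ := hΨ.localInverse_apply_image hdΨ (by simp)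
  have hr := (hΨ.hasStrictFDerivAt' hdΨ (by simp)).eventually_right_inverse
  change ∀ᶠ y in 𝓝 (Ψ 0), Ψ (hΨ.localInverse hdΨ (by simp) y) = y at hr
  set l := hΨ.localInverse hdΨ (by simp)
  rw [hΨ₀] at hl hl₀ hr
  have hlc : ContMDiffAt J 𝓘(ℝ, F) ∞ (fun y => l (extChartAt J (f p) y)) (f p) :=
    hl.contMDiffAt.comp (f p) contMDiffAt_extChartAt
  have hσ : ContMDiffAt J I ∞ (fun y => A (l (extChartAt J (f p) y))) (f p) := by
    refine ContMDiffAt.comp (g := A) (f p) ?_ hlc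
    rwa [hl₀]
  refine ⟨fun y => A (l (extChartAt J (f p) y)), hσ, by simp only [hl₀, hA₀], ?_⟩
  have hcont : ContinuousAt (fun y => f (A (l (extChartAt J (f p) y)))) (f p) := by
    refine ContinuousAt.comp (f := fun y => A (l (extChartAt J (f p) y))) ?_ hσ.continuousAt
    simp only [hl₀]
    exact hfA.continuousAt
  have hmem : ∀ᶠ y in 𝓝 (f p), f (A (l (extChartAt J (f p) y))) ∈ (extChartAt J (f p)).source := by
    refine hcont ?_
    simp only [hl₀, hA₀]
    exact extChartAt_source_mem_nhds (f p)
  filter_upwards [hmem, extChartAt_source_mem_nhds (I := J) (f p),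
    (continuousAt_extChartAt (I := J) (f p)).eventually hr] with y h1 h2 h3
  exact (extChartAt J (f p)).injOn h1 h2 h3

/-- If `f₁ p = f₂ p` and the pair consisting of the difference of the derivatives of `f₁` and `f₂`
and of the derivative of `h` is surjective at `p`, then `h` has a smooth section near `h p` that
takes values in the equalizer of `f₁` and `f₂`. -/
theorem exists_contMDiffAt_section_of_equalizer [FiniteDimensional ℝ E']
    [IsManifold I ∞ X] [IsManifold J ∞ Y]
    [IsManifold I' ∞ Z] {f₁ f₂ : X → Y} {h : X → Z} {p : X}
    (h₁ : ContMDiffAt I J ∞ f₁ p) (h₂ : ContMDiffAt I J ∞ f₂ p) (hh : ContMDiffAt I I' ∞ h p)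
    (hp : f₁ p = f₂ p)
    (hsurj : ∀ w u, ∃ v, modelDeriv I J f₁ p v - modelDeriv I J f₂ p v = w ∧
      modelDeriv I I' h p v = u) :
    ∃ σ : Z → X, ContMDiffAt I' I ∞ σ (h p) ∧ σ (h p) = p ∧
      ∀ᶠ z in 𝓝 (h p), f₁ (σ z) = f₂ (σ z) ∧ h (σ z) = z := by
  have : IsManifold J 1 Y := IsManifold.of_le (n := ∞) (by simp)
  let e := extChartAt J (f₁ p)
  have he₁ : ContMDiffAt J 𝓘(ℝ, F) ∞ e (f₁ p) := contMDiffAt_extChartAt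
  have he₂ : ContMDiffAt J 𝓘(ℝ, F) ∞ e (f₂ p) := hp ▸ he₁
  have hg₁ : ContMDiffAt I 𝓘(ℝ, F) ∞ (fun x => e (f₁ x)) p := he₁.comp p h₁
  have hg₂ : ContMDiffAt I 𝓘(ℝ, F) ∞ (fun x => e (f₂ x)) p := he₂.comp p h₂
  have hd : ContMDiffAt I 𝓘(ℝ, F) ∞ (fun x => e (f₁ x) - e (f₂ x)) p := hg₁.sub hg₂
  have md {f : X → Y} (hf : ContMDiffAt I J ∞ f p) : MDifferentiableAt I J f p :=
    hf.mdifferentiableAt (by simp)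
  have hder : modelDeriv I (𝓘(ℝ, F).prod I') (fun x => (e (f₁ x) - e (f₂ x), h x)) p =
      (modelDeriv I J f₁ p - modelDeriv I J f₂ p).prod (modelDeriv I I' h p) := by
    rw [modelDeriv_prodMk (hd.mdifferentiableAt (by simp)) (hh.mdifferentiableAt (by simp)),
      modelDeriv_sub (hg₁.mdifferentiableAt (by simp)) (hg₂.mdifferentiableAt (by simp)),
      modelDeriv_comp p (he₁.mdifferentiableAt (by simp)) (md h₁),
      modelDeriv_comp p (he₂.mdifferentiableAt (by simp)) (md h₂), ← hp,
      modelDeriv_extChartAt_self, ContinuousLinearMap.id_comp, ContinuousLinearMap.id_comp]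
  obtain ⟨s, hs, hsp, hsr⟩ := exists_contMDiffAt_section
    (f := fun x => (e (f₁ x) - e (f₂ x), h x)) (J := 𝓘(ℝ, F).prod I') (hd.prodMk hh)
    (by
      rw [hder]
      rintro ⟨w, u⟩
      obtain ⟨v, hv, hv'⟩ := hsurj w u
      exact ⟨v, Prod.ext hv hv'⟩)
  have h0 : (e (f₁ p) - e (f₂ p), h p) = ((0 : F), h p) := by rw [hp, sub_self]
  rw [h0] at hs hsp hsr
  have hi : ContMDiffAt I' (𝓘(ℝ, F).prod I') ∞ (fun z : Z => ((0 : F), z)) (h p) :=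
    contMDiffAt_const.prodMk contMDiffAt_id
  have hσ : ContMDiffAt I' I ∞ (fun z => s (0, z)) (h p) := hs.comp (h p) hi
  refine ⟨fun z => s (0, z), hσ, hsp, ?_⟩
  have hsrc {f : X → Y} (hf : ContMDiffAt I J ∞ f p) (hfp : f p = f₁ p) :
      ∀ᶠ z in 𝓝 (h p), f (s (0, z)) ∈ e.source := by
    have : ContinuousAt (fun z => f (s (0, z))) (h p) := by
      refine ContinuousAt.comp (f := fun z => s (0, z)) ?_ hσ.continuousAt
      simp only [hsp]
      exact hf.continuousAt
    refine this ?_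
    simp only [hsp, hfp]
    exact extChartAt_source_mem_nhds _
  filter_upwards [hsrc h₁ rfl, hsrc h₂ hp.symm, hi.continuousAt.eventually hsr] with z z₁ z₂ z₃
  exact ⟨e.injOn z₁ z₂ (sub_eq_zero.1 (congrArg Prod.fst z₃)), congrArg Prod.snd z₃⟩

/-- If `f₁ p = f₂ p` and the difference of the derivatives of `f₁` and `f₂` at `p` is surjective,
then every vector on which these derivatives agree is the velocity of a curve in the equalizer of
`f₁` and `f₂`. -/
theorem exists_curve_of_equalizer [FiniteDimensional ℝ E] [IsManifold I ∞ X] [IsManifold J ∞ Y]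
    {f₁ f₂ : X → Y} {p : X} (h₁ : ContMDiffAt I J ∞ f₁ p) (h₂ : ContMDiffAt I J ∞ f₂ p)
    (hp : f₁ p = f₂ p)
    (hsurj : ∀ w, ∃ v, modelDeriv I J f₁ p v - modelDeriv I J f₂ p v = w)
    {v : E} (hv : modelDeriv I J f₁ p v = modelDeriv I J f₂ p v) :
    ∃ c : ℝ → X, c 0 = p ∧ MDifferentiableAt 𝓘(ℝ, ℝ) I c 0 ∧ modelDeriv 𝓘(ℝ, ℝ) I c 0 1 = v ∧
      ∀ᶠ t in 𝓝 0, f₁ (c t) = f₂ (c t) := by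
  have : IsManifold I 1 X := IsManifold.of_le (n := ∞) (by simp)
  let δ : E →L[ℝ] F := modelDeriv I J f₁ p - modelDeriv I J f₂ p
  have hδv : δ v = 0 := sub_eq_zero.2 hv
  -- a retraction `q` onto the kernel of `δ` makes the pair `(δ, q)` bijective
  obtain ⟨q₀, hq₀⟩ := LinearMap.exists_leftInverse_of_injective
    (LinearMap.ker (δ : E →ₗ[ℝ] F)).subtype (Submodule.ker_subtype _)
  let q : E →L[ℝ] LinearMap.ker (δ : E →ₗ[ℝ] F) := LinearMap.toContinuousLinearMap q₀
  have hq (k : LinearMap.ker (δ : E →ₗ[ℝ] F)) : q k = k := congr($hq₀ k)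
  have hc : ContMDiffAt I 𝓘(ℝ, E) ∞ (extChartAt I p) p := contMDiffAt_extChartAt
  have hqs : ContMDiffAt 𝓘(ℝ, E) 𝓘(ℝ, LinearMap.ker (δ : E →ₗ[ℝ] F)) ∞ q (extChartAt I p p) :=
    q.contDiff.contDiffAt.contMDiffAt
  let h : X → LinearMap.ker (δ : E →ₗ[ℝ] F) := fun x => q (extChartAt I p x)
  have hh : ContMDiffAt I 𝓘(ℝ, LinearMap.ker (δ : E →ₗ[ℝ] F)) ∞ h p := hqs.comp p hc
  have hdh : modelDeriv I 𝓘(ℝ, LinearMap.ker (δ : E →ₗ[ℝ] F)) h p = q := by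
    rw [modelDeriv_comp p (hqs.mdifferentiableAt (by simp)) (hc.mdifferentiableAt (by simp)),
      modelDeriv_extChartAt_self, modelDeriv_eq_fderiv, q.fderiv, ContinuousLinearMap.comp_id]
  obtain ⟨σ, hσ, hσp, hσe⟩ := exists_contMDiffAt_section_of_equalizer h₁ h₂ hh hp (by
    intro w u
    obtain ⟨v, hv⟩ := hsurj w
    refine ⟨v - (q v : E) + u, ?_, ?_⟩
    · change δ (v - (q v : E) + u) = w
      rw [map_add, map_sub, show δ (q v) = 0 from (q v).2, show δ u = 0 from u.2, sub_zero,
        add_zero]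
      exact hv
    · rw [hdh, map_add, map_sub, hq, hq, sub_self, zero_add])
  let ℓ : ℝ → LinearMap.ker (δ : E →ₗ[ℝ] F) := fun t => h p + t • ⟨v, hδv⟩
  have hℓ₀ : ℓ 0 = h p := by simp [ℓ]
  have hℓ : HasDerivAt ℓ ⟨v, hδv⟩ 0 := by
    have := ((hasDerivAt_id (0 : ℝ)).smul_const
      (⟨v, hδv⟩ : LinearMap.ker (δ : E →ₗ[ℝ] F))).const_add (h p)
    rwa [one_smul] at this
  have hℓm : MDifferentiableAt 𝓘(ℝ, ℝ) 𝓘(ℝ, LinearMap.ker (δ : E →ₗ[ℝ] F)) ℓ 0 :=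
    hℓ.differentiableAt.mdifferentiableAt
  have hℓd : modelDeriv 𝓘(ℝ, ℝ) 𝓘(ℝ, LinearMap.ker (δ : E →ₗ[ℝ] F)) ℓ 0 1 = ⟨v, hδv⟩ := by
    rw [modelDeriv_eq_fderiv]
    exact hℓ.deriv
  have hcm : MDifferentiableAt 𝓘(ℝ, ℝ) I (fun t => σ (ℓ t)) 0 := by
    refine MDifferentiableAt.comp (0 : ℝ) ?_ hℓm
    rw [hℓ₀]
    exact hσ.mdifferentiableAt (by simp)
  have hc₀ : σ (ℓ 0) = p := by rw [hℓ₀, hσp]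
  have hev : ∀ᶠ t in 𝓝 (0 : ℝ), f₁ (σ (ℓ t)) = f₂ (σ (ℓ t)) ∧ h (σ (ℓ t)) = ℓ t := by
    have := hℓ.continuousAt
    rw [ContinuousAt, hℓ₀] at this
    exact this.eventually hσe
  refine ⟨fun t => σ (ℓ t), hc₀, hcm, ?_, hev.mono fun t ht => ht.1⟩
  set w := modelDeriv 𝓘(ℝ, ℝ) I (fun t => σ (ℓ t)) 0 1
  have e₁ : modelDeriv I J f₁ p w = modelDeriv I J f₂ p w := by
    have := modelDeriv_congr (I := 𝓘(ℝ, ℝ)) (J := J) (hev.mono fun t ht => ht.1)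
    rw [modelDeriv_comp 0 (by rw [hc₀]; exact h₁.mdifferentiableAt (by simp)) hcm,
      modelDeriv_comp 0 (by rw [hc₀]; exact h₂.mdifferentiableAt (by simp)) hcm, hc₀] at this
    exact congr($this 1)
  have e₂ : q w = ⟨v, hδv⟩ := by
    have := modelDeriv_congr (I := 𝓘(ℝ, ℝ)) (J := 𝓘(ℝ, LinearMap.ker (δ : E →ₗ[ℝ] F)))
      (hev.mono fun t ht => ht.2)
    rw [modelDeriv_comp 0 (by rw [hc₀]; exact hh.mdifferentiableAt (by simp)) hcm, hc₀, hdh] at this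
    exact congr($this 1).trans hℓd
  have hw : w ∈ LinearMap.ker (δ : E →ₗ[ℝ] F) := sub_eq_zero.2 e₁
  have := (hq ⟨w, hw⟩).symm.trans e₂
  exact congrArg Subtype.val this

end ModelDeriv

/-! ### The tangent groupoid, recorded by its source and target vectors -/

/-- The value of a field of forms at a point, as a form on the model vector space. -/
def FormField.atPoint {m k : ℕ} {M : Type*} [TopologicalSpace M]
    [ChartedSpace (EuclideanSpace ℝ (Fin m)) M] (α : FormField m k M) (x : M) :
    EuclideanSpace ℝ (Fin m) [⋀^Fin k]→L[ℝ] ℝ := α x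

/-- The bilinear form `(v, w) ↦ ♭_x(v)(w)`, on the model vector space. -/
def lichnerowiczForm {m : ℕ} {M : Type*} [TopologicalSpace M]
    [ChartedSpace (EuclideanSpace ℝ (Fin m)) M] (ϖ : FormField m 2 M) (η : FormField m 1 M)
    (x : M) (v w : EuclideanSpace ℝ (Fin m)) : ℝ :=
  ϖ.atPoint x ![v, w] + η.atPoint x ![v] * η.atPoint x ![w]

namespace LieGroupoid

open Filter Topology Module

variable {m n : ℕ} {M G : Type*}
  [TopologicalSpace M] [ChartedSpace (EuclideanSpace ℝ (Fin m)) M] [IsManifold (𝓡 m) ∞ M]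
  [TopologicalSpace G] [ChartedSpace (EuclideanSpace ℝ (Fin n)) G] [IsManifold (𝓡 n) ∞ G]
  (𝒢 : LieGroupoid m n M G)

/-- The derivative of the source map at an arrow. -/
def dsrc (g : G) : EuclideanSpace ℝ (Fin n) →L[ℝ] EuclideanSpace ℝ (Fin m) :=
  modelDeriv (𝓡 n) (𝓡 m) 𝒢.src g

/-- The derivative of the target map at an arrow. -/
def dtgt (g : G) : EuclideanSpace ℝ (Fin n) →L[ℝ] EuclideanSpace ℝ (Fin m) :=
  modelDeriv (𝓡 n) (𝓡 m) 𝒢.tgt g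

theorem contMDiff_src : ContMDiff (𝓡 n) (𝓡 m) ∞ 𝒢.src := 𝒢.submersion_src.contMDiff

theorem contMDiff_tgt : ContMDiff (𝓡 n) (𝓡 m) ∞ 𝒢.tgt := 𝒢.submersion_tgt.contMDiff

theorem mdifferentiable_src : MDifferentiable (𝓡 n) (𝓡 m) 𝒢.src :=
  𝒢.contMDiff_src.mdifferentiable (by simp)

theorem mdifferentiable_tgt : MDifferentiable (𝓡 n) (𝓡 m) 𝒢.tgt :=
  𝒢.contMDiff_tgt.mdifferentiable (by simp)

theorem mdifferentiable_unit : MDifferentiable (𝓡 m) (𝓡 n) 𝒢.unit :=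
  𝒢.smooth_unit.mdifferentiable (by simp)

theorem mdifferentiable_inv : MDifferentiable (𝓡 n) (𝓡 n) 𝒢.inv :=
  𝒢.smooth_inv.mdifferentiable (by simp)

theorem dsrc_surjective (g : G) : Function.Surjective (𝒢.dsrc g) :=
  (𝒢.submersion_src.isSubmersionAt g).modelDeriv_surjective

theorem dtgt_surjective (g : G) : Function.Surjective (𝒢.dtgt g) :=
  (𝒢.submersion_tgt.isSubmersionAt g).modelDeriv_surjective

/-- The relation between vectors at the source and at the target of `g` given by the tangent
vectors at `g`: the pairs `(ds a, dt a)`, for `a` in `T_g G`. -/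
def arrowTangent (g : G) :
    Submodule ℝ (EuclideanSpace ℝ (Fin m) × EuclideanSpace ℝ (Fin m)) :=
  LinearMap.range ((𝒢.dsrc g).prod (𝒢.dtgt g)).toLinearMap

variable {𝒢}

theorem mem_arrowTangent {g : G} {p : EuclideanSpace ℝ (Fin m) × EuclideanSpace ℝ (Fin m)} :
    p ∈ 𝒢.arrowTangent g ↔ ∃ a, 𝒢.dsrc g a = p.1 ∧ 𝒢.dtgt g a = p.2 := by
  simp [arrowTangent, Prod.ext_iff]

variable (𝒢)

theorem mem_arrowTangent_unit (x : M) (v : EuclideanSpace ℝ (Fin m)) :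
    (v, v) ∈ 𝒢.arrowTangent (𝒢.unit x) := by
  refine mem_arrowTangent.2 ⟨modelDeriv (𝓡 m) (𝓡 n) 𝒢.unit x v, ?_, ?_⟩
  · have h := modelDeriv_comp_apply x (𝒢.mdifferentiable_src _) (𝒢.mdifferentiable_unit x) v
    simp only [𝒢.src_unit, modelDeriv_id] at h
    exact h.symm
  · have h := modelDeriv_comp_apply x (𝒢.mdifferentiable_tgt _) (𝒢.mdifferentiable_unit x) v
    simp only [𝒢.tgt_unit, modelDeriv_id] at h
    exact h.symm

theorem exists_mem_arrowTangent_left (g : G) (u : EuclideanSpace ℝ (Fin m)) :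
    ∃ v, (u, v) ∈ 𝒢.arrowTangent g := by
  obtain ⟨a, ha⟩ := 𝒢.dsrc_surjective g u
  exact ⟨_, mem_arrowTangent.2 ⟨a, ha, rfl⟩⟩

theorem exists_mem_arrowTangent_right (g : G) (v : EuclideanSpace ℝ (Fin m)) :
    ∃ u, (u, v) ∈ 𝒢.arrowTangent g := by
  obtain ⟨a, ha⟩ := 𝒢.dtgt_surjective g v
  exact ⟨_, mem_arrowTangent.2 ⟨a, rfl, ha⟩⟩

theorem mem_arrowTangent_inv {g : G} {u v : EuclideanSpace ℝ (Fin m)}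
    (h : (u, v) ∈ 𝒢.arrowTangent g) : (v, u) ∈ 𝒢.arrowTangent (𝒢.inv g) := by
  obtain ⟨a, rfl, rfl⟩ := mem_arrowTangent.1 h
  refine mem_arrowTangent.2 ⟨modelDeriv (𝓡 n) (𝓡 n) 𝒢.inv g a, ?_, ?_⟩
  · have h := modelDeriv_comp_apply g (𝒢.mdifferentiable_src _) (𝒢.mdifferentiable_inv g) a
    simp only [𝒢.src_inv] at h
    exact h.symm
  · have h := modelDeriv_comp_apply g (𝒢.mdifferentiable_tgt _) (𝒢.mdifferentiable_inv g) a
    simp only [𝒢.tgt_inv] at h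
    exact h.symm

/-- Composable tangent vectors can be multiplied: they are represented by a curve of composable
pairs of arrows. -/
theorem mem_arrowTangent_mul {g h : G} (hgh : 𝒢.src g = 𝒢.tgt h)
    {u v w : EuclideanSpace ℝ (Fin m)} (hh : (u, v) ∈ 𝒢.arrowTangent h)
    (hg : (v, w) ∈ 𝒢.arrowTangent g) : (u, w) ∈ 𝒢.arrowTangent (𝒢.mul g h) := by
  obtain ⟨b, rfl, hb⟩ := mem_arrowTangent.1 hh
  obtain ⟨a, ha, rfl⟩ := mem_arrowTangent.1 hg
  dsimp only at ha hb
  have m₁ : MDifferentiable ((𝓡 n).prod (𝓡 n)) (𝓡 n) (fun p : G × G => p.1) :=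
    contMDiff_fst.mdifferentiable (n := ∞) (by simp)
  have m₂ : MDifferentiable ((𝓡 n).prod (𝓡 n)) (𝓡 n) (fun p : G × G => p.2) :=
    contMDiff_snd.mdifferentiable (n := ∞) (by simp)
  have d₁ : modelDeriv ((𝓡 n).prod (𝓡 n)) (𝓡 m) (fun p : G × G => 𝒢.src p.1) (g, h) =
      (𝒢.dsrc g).comp (.fst ℝ _ _) := by
    rw [modelDeriv_comp _ (𝒢.mdifferentiable_src _) (m₁ _), modelDeriv_fst]; rfl
  have d₂ : modelDeriv ((𝓡 n).prod (𝓡 n)) (𝓡 m) (fun p : G × G => 𝒢.tgt p.2) (g, h) =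
      (𝒢.dtgt h).comp (.snd ℝ _ _) := by
    rw [modelDeriv_comp _ (𝒢.mdifferentiable_tgt _) (m₂ _), modelDeriv_snd]; rfl
  obtain ⟨c, hc₀, hc, hcv, hce⟩ := exists_curve_of_equalizer
    (I := (𝓡 n).prod (𝓡 n)) (J := 𝓡 m) (f₁ := fun p : G × G => 𝒢.src p.1)
    (f₂ := fun p : G × G => 𝒢.tgt p.2) (p := (g, h)) (v := (a, b))
    ((𝒢.contMDiff_src.comp contMDiff_fst) _) ((𝒢.contMDiff_tgt.comp contMDiff_snd) _) hgh
    (by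
      intro w
      obtain ⟨z, hz⟩ := 𝒢.dsrc_surjective g w
      exact ⟨(z, 0), by simp [d₁, d₂, hz]⟩)
    (by simp [d₁, d₂, ha, hb])
  have hγ : MDifferentiableAt 𝓘(ℝ, ℝ) (𝓡 n) (fun t => 𝒢.mul (c t).1 (c t).2) 0 := by
    refine MDifferentiableWithinAt.comp_curve
      ((𝒢.smooth_mul.mdifferentiableOn (by simp)) (c 0) ?_) hc hce
    rw [hc₀]; exact hgh
  have hc₁ : MDifferentiableAt 𝓘(ℝ, ℝ) (𝓡 n) (fun t => (c t).1) 0 :=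
    (m₁ (c 0)).comp (0 : ℝ) hc
  have hc₂ : MDifferentiableAt 𝓘(ℝ, ℝ) (𝓡 n) (fun t => (c t).2) 0 :=
    (m₂ (c 0)).comp (0 : ℝ) hc
  have e₁ : modelDeriv 𝓘(ℝ, ℝ) (𝓡 n) (fun t => (c t).1) 0 1 = a := by
    rw [modelDeriv_comp_apply 0 (m₁ _) hc, hcv, modelDeriv_fst]; rfl
  have e₂ : modelDeriv 𝓘(ℝ, ℝ) (𝓡 n) (fun t => (c t).2) 0 1 = b := by
    rw [modelDeriv_comp_apply 0 (m₂ _) hc, hcv, modelDeriv_snd]; rfl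
  refine mem_arrowTangent.2
    ⟨modelDeriv 𝓘(ℝ, ℝ) (𝓡 n) (fun t => 𝒢.mul (c t).1 (c t).2) 0 1, ?_, ?_⟩
  · have key := modelDeriv_congr (I := 𝓘(ℝ, ℝ)) (J := 𝓡 m)
      (hce.mono fun t ht => 𝒢.src_mul (c t).1 (c t).2 ht)
    have key := congr($key 1)
    rw [modelDeriv_comp_apply 0 (𝒢.mdifferentiable_src _) hγ,
      modelDeriv_comp_apply 0 (𝒢.mdifferentiable_src _) hc₂, e₂, hc₀] at key
    exact key
  · have key := modelDeriv_congr (I := 𝓘(ℝ, ℝ)) (J := 𝓡 m)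
      (hce.mono fun t ht => 𝒢.tgt_mul (c t).1 (c t).2 ht)
    have key := congr($key 1)
    rw [modelDeriv_comp_apply 0 (𝒢.mdifferentiable_tgt _) hγ,
      modelDeriv_comp_apply 0 (𝒢.mdifferentiable_tgt _) hc₁, e₁, hc₀] at key
    exact key

/-- The target vectors of the tangent vectors at `g` with vanishing source are those at the unit of
the target of `g`, that is, they form the image of the anchor. -/
theorem zero_mem_arrowTangent_iff (g : G) (v : EuclideanSpace ℝ (Fin m)) :
    (0, v) ∈ 𝒢.arrowTangent g ↔ (0, v) ∈ 𝒢.arrowTangent (𝒢.unit (𝒢.tgt g)) := by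
  constructor
  · intro h
    have h0 : ((0, 0) : EuclideanSpace ℝ (Fin m) × EuclideanSpace ℝ (Fin m)) ∈
        𝒢.arrowTangent (𝒢.inv g) := zero_mem _
    have := 𝒢.mem_arrowTangent_mul (𝒢.tgt_inv g).symm h0 h
    rwa [𝒢.mul_inv] at this
  · intro h
    have h0 : ((0, 0) : EuclideanSpace ℝ (Fin m) × EuclideanSpace ℝ (Fin m)) ∈
        𝒢.arrowTangent g := zero_mem _
    have := 𝒢.mem_arrowTangent_mul (𝒢.src_unit _) h0 h
    rwa [𝒢.unit_mul] at this

theorem finrank_arrowTangent (g : G) :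
    finrank ℝ (𝒢.arrowTangent g) =
      m + finrank ℝ ((𝒢.arrowTangent g).comap (LinearMap.inr ℝ _ _)) := by
  let f := (LinearMap.fst ℝ (EuclideanSpace ℝ (Fin m)) (EuclideanSpace ℝ (Fin m))).domRestrict
    (𝒢.arrowTangent g)
  have hf : LinearMap.range f = ⊤ := by
    rw [LinearMap.range_eq_top]
    intro u
    obtain ⟨v, hv⟩ := 𝒢.exists_mem_arrowTangent_left g u
    exact ⟨⟨(u, v), hv⟩, rfl⟩
  let e : (𝒢.arrowTangent g).comap
      (LinearMap.inr ℝ (EuclideanSpace ℝ (Fin m)) (EuclideanSpace ℝ (Fin m))) →ₗ[ℝ]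
        LinearMap.ker f :=
    { toFun := fun v => ⟨⟨(0, v.1), v.2⟩, rfl⟩
      map_add' := fun v w => Subtype.ext (Subtype.ext (Prod.ext (add_zero _).symm rfl))
      map_smul' := fun c v => Subtype.ext (Subtype.ext (Prod.ext (smul_zero _).symm rfl)) }
  have he : Function.Bijective e := by
    constructor
    · intro v w h
      exact Subtype.ext (congrArg (fun z => z.1.1.2) h)
    · rintro ⟨⟨⟨u, v⟩, h⟩, h'⟩
      have hu : u = 0 := h'
      subst hu
      exact ⟨⟨v, h⟩, rfl⟩
  have h1 := LinearMap.finrank_range_add_finrank_ker f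
  rw [hf, finrank_top, finrank_euclideanSpace_fin,
    ← (LinearEquiv.ofBijective e he).finrank_eq] at h1
  exact h1.symm

theorem finrank_arrowTangent_eq_unit (g : G) :
    finrank ℝ (𝒢.arrowTangent g) = finrank ℝ (𝒢.arrowTangent (𝒢.unit (𝒢.tgt g))) := by
  have h : (𝒢.arrowTangent g).comap (LinearMap.inr ℝ _ _) =
      (𝒢.arrowTangent (𝒢.unit (𝒢.tgt g))).comap (LinearMap.inr ℝ _ _) :=
    Submodule.ext fun v => 𝒢.zero_mem_arrowTangent_iff g v
  rw [finrank_arrowTangent, finrank_arrowTangent, h]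

theorem finrank_arrowTangent_le_inv (g : G) :
    finrank ℝ (𝒢.arrowTangent g) ≤ finrank ℝ (𝒢.arrowTangent (𝒢.inv g)) := by
  let f : 𝒢.arrowTangent g →ₗ[ℝ] 𝒢.arrowTangent (𝒢.inv g) :=
    { toFun := fun p => ⟨(p.1.2, p.1.1), 𝒢.mem_arrowTangent_inv p.2⟩
      map_add' := fun _ _ => rfl
      map_smul' := fun _ _ => rfl }
  refine LinearMap.finrank_le_finrank_of_injective (f := f) fun p q h => ?_
  have h' := congrArg Subtype.val h
  exact Subtype.ext (Prod.ext (congrArg Prod.snd h') (congrArg Prod.fst h'))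

/-- The rank of the anchor is constant along orbits. -/
theorem finrank_arrowTangent_unit_eq (g : G) :
    finrank ℝ (𝒢.arrowTangent (𝒢.unit (𝒢.src g))) =
      finrank ℝ (𝒢.arrowTangent (𝒢.unit (𝒢.tgt g))) := by
  have h1 := 𝒢.finrank_arrowTangent_le_inv g
  have h2 := 𝒢.finrank_arrowTangent_le_inv (𝒢.inv g)
  have h3 := 𝒢.finrank_arrowTangent_eq_unit (𝒢.inv (𝒢.inv g))
  have h4 := 𝒢.finrank_arrowTangent_eq_unit (𝒢.inv g)
  rw [𝒢.tgt_inv, 𝒢.src_inv] at h3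
  rw [𝒢.tgt_inv] at h4
  rw [𝒢.finrank_arrowTangent_eq_unit g] at h1
  omega

theorem exists_anchor_eq_iff (x : M) (v : TangentSpace (𝓡 m) x) :
    (∃ a, 𝒢.anchor x a = v) ↔ ((0, v) : EuclideanSpace ℝ (Fin m) × EuclideanSpace ℝ (Fin m)) ∈
      𝒢.arrowTangent (𝒢.unit x) := by
  rw [mem_arrowTangent]
  exact ⟨fun ⟨a, ha⟩ => ⟨a.1, a.2, ha⟩, fun ⟨a, ha, ha'⟩ => ⟨⟨a, ha⟩, ha'⟩⟩

theorem anchor_injective_iff (x : M) :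
    (∀ a, 𝒢.anchor x a = 0 → a = 0) ↔
      ∀ a, 𝒢.dsrc (𝒢.unit x) a = 0 → 𝒢.dtgt (𝒢.unit x) a = 0 → a = 0 :=
  ⟨fun h a ha ha' => congrArg Subtype.val (h ⟨a, ha⟩ ha'),
    fun h a ha => Subtype.ext (h a.1 a.2 ha)⟩

theorem anchor_injective_iff_finrank (x : M) :
    (∀ a, 𝒢.anchor x a = 0 → a = 0) ↔ finrank ℝ (𝒢.arrowTangent (𝒢.unit x)) = n := by
  rw [anchor_injective_iff]
  let f := ((𝒢.dsrc (𝒢.unit x)).prod (𝒢.dtgt (𝒢.unit x))).toLinearMap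
  have hr := LinearMap.finrank_range_add_finrank_ker f
  rw [finrank_euclideanSpace_fin] at hr
  change finrank ℝ (𝒢.arrowTangent (𝒢.unit x)) + _ = n at hr
  have hk : finrank ℝ (LinearMap.ker f) = 0 ↔
      ∀ a, 𝒢.dsrc (𝒢.unit x) a = 0 → 𝒢.dtgt (𝒢.unit x) a = 0 → a = 0 := by
    rw [Submodule.finrank_eq_zero, LinearMap.ker_eq_bot']
    exact ⟨fun h a h1 h2 => h a (Prod.ext h1 h2),
      fun h a h' => h a (congrArg Prod.fst h') (congrArg Prod.snd h')⟩
  rw [← hk]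
  omega

/-- A form is basic if and only if it takes the same values on source and on target vectors. -/
theorem isBasic_iff {k : ℕ} {α : FormField m k M} :
    𝒢.IsBasic α ↔ ∀ (g : G) (u v : Fin k → EuclideanSpace ℝ (Fin m)),
      (∀ i, (u i, v i) ∈ 𝒢.arrowTangent g) →
        α.atPoint (𝒢.tgt g) v = α.atPoint (𝒢.src g) u := by
  constructor
  · intro h g u v huv
    choose a ha using fun i => mem_arrowTangent.1 (huv i)
    have hu : (fun i => 𝒢.dsrc g (a i)) = u := funext fun i => (ha i).1
    have hv : (fun i => 𝒢.dtgt g (a i)) = v := funext fun i => (ha i).2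
    have := congrArg (fun β => β a) (congrFun h g)
    rw [← hu, ← hv]
    exact this
  · intro h
    funext g
    refine ContinuousAlternatingMap.ext fun a => ?_
    exact h g (fun i => 𝒢.dsrc g (a i)) (fun i => 𝒢.dtgt g (a i))
      fun i => mem_arrowTangent.2 ⟨a i, rfl, rfl⟩

theorem lichnerowiczForm_tgt {ϖ : FormField m 2 M} {η : FormField m 1 M}
    (hϖ : 𝒢.IsBasic ϖ) (hη : 𝒢.IsBasic η) (g : G) {u v u' v' : EuclideanSpace ℝ (Fin m)}
    (h : (u, v) ∈ 𝒢.arrowTangent g) (h' : (u', v') ∈ 𝒢.arrowTangent g) :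
    lichnerowiczForm ϖ η (𝒢.tgt g) v v' = lichnerowiczForm ϖ η (𝒢.src g) u u' := by
  rw [isBasic_iff] at hϖ hη
  rw [lichnerowiczForm, lichnerowiczForm,
    hϖ g ![u, u'] ![v, v'] (by simp [Fin.forall_fin_two, h, h']),
    hη g ![u] ![v] (by simp [h]), hη g ![u'] ![v'] (by simp [h'])]

/-- The Lichnerowicz map is a quasi-isomorphism at `x` if and only if the anchor is injective
at `x` and the kernel of `♭_x` consists of the target vectors of tangent vectors with vanishing
source. -/
theorem quasiIso_lichnerowiczMap_iff_arrowTangent {ϖ : FormField m 2 M} {η : FormField m 1 M}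
    (hϖ : 𝒢.IsBasic ϖ) (hη : 𝒢.IsBasic η) (x : M) :
    QuasiIso (𝒢.lichnerowiczMap hϖ hη x) ↔
      (∀ a, 𝒢.anchor x a = 0 → a = 0) ∧
        ∀ v, (∀ w, lichnerowiczForm ϖ η x v w = 0) → (0, v) ∈ 𝒢.arrowTangent (𝒢.unit x) := by
  rw [quasiIso_lichnerowiczMap_iff]
  refine and_congr_right fun _ => forall_congr' fun v => ?_
  rw [← exists_anchor_eq_iff]
  exact imp_congr_left LinearMap.ext_iff

theorem quasiIso_lichnerowiczMap_tgt {ϖ : FormField m 2 M} {η : FormField m 1 M}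
    (hϖ : 𝒢.IsBasic ϖ) (hη : 𝒢.IsBasic η) (g : G)
    (h : QuasiIso (𝒢.lichnerowiczMap hϖ hη (𝒢.src g))) :
    QuasiIso (𝒢.lichnerowiczMap hϖ hη (𝒢.tgt g)) := by
  rw [quasiIso_lichnerowiczMap_iff_arrowTangent, anchor_injective_iff_finrank] at h ⊢
  refine ⟨(𝒢.finrank_arrowTangent_unit_eq g).symm.trans h.1, fun v hv => ?_⟩
  obtain ⟨u, huv⟩ := 𝒢.exists_mem_arrowTangent_right g v
  have hu : (0, u) ∈ 𝒢.arrowTangent (𝒢.unit (𝒢.src g)) := by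
    refine h.2 u fun w => ?_
    obtain ⟨w', hw⟩ := 𝒢.exists_mem_arrowTangent_left g w
    rw [← 𝒢.lichnerowiczForm_tgt hϖ hη g huv hw, hv]
  have := 𝒢.mem_arrowTangent_mul (𝒢.tgt_unit _).symm hu huv
  rw [𝒢.mul_unit] at this
  exact (𝒢.zero_mem_arrowTangent_iff g v).1 this

end LieGroupoid

/-! ### Morita maps and tangent vectors -/

namespace LieGroupoid.Hom

open Filter Topology Module

variable {m n : ℕ} {M G : Type*}
  [TopologicalSpace M] [ChartedSpace (EuclideanSpace ℝ (Fin m)) M] [IsManifold (𝓡 m) ∞ M]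
  [TopologicalSpace G] [ChartedSpace (EuclideanSpace ℝ (Fin n)) G] [IsManifold (𝓡 n) ∞ G]
  {m' n' : ℕ} {M' G' : Type*}
  [TopologicalSpace M'] [ChartedSpace (EuclideanSpace ℝ (Fin m')) M'] [IsManifold (𝓡 m') ∞ M']
  [TopologicalSpace G'] [ChartedSpace (EuclideanSpace ℝ (Fin n')) G'] [IsManifold (𝓡 n') ∞ G']
  {𝒢' : LieGroupoid m' n' M' G'} {𝒢 : LieGroupoid m n M G} (φ : Hom 𝒢' 𝒢)

/-- The derivative of a morphism of Lie groupoids on objects. -/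
def dObj (y : M') : EuclideanSpace ℝ (Fin m') →L[ℝ] EuclideanSpace ℝ (Fin m) :=
  modelDeriv (𝓡 m') (𝓡 m) φ.onObj y

/-- The derivative of a morphism of Lie groupoids on arrows. -/
def dArr (g : G') : EuclideanSpace ℝ (Fin n') →L[ℝ] EuclideanSpace ℝ (Fin n) :=
  modelDeriv (𝓡 n') (𝓡 n) φ.onArr g

theorem mdifferentiable_onObj : MDifferentiable (𝓡 m') (𝓡 m) φ.onObj :=
  φ.smooth_onObj.mdifferentiable (by simp)

theorem mdifferentiable_onArr : MDifferentiable (𝓡 n') (𝓡 n) φ.onArr :=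
  φ.smooth_onArr.mdifferentiable (by simp)

theorem dsrc_dArr (g : G') (a : EuclideanSpace ℝ (Fin n')) :
    𝒢.dsrc (φ.onArr g) (φ.dArr g a) = φ.dObj (𝒢'.src g) (𝒢'.dsrc g a) := by
  rw [dsrc, dArr, ← modelDeriv_comp_apply g (𝒢.mdifferentiable_src _) (φ.mdifferentiable_onArr _),
    dsrc, dObj, ← modelDeriv_comp_apply g (φ.mdifferentiable_onObj _) (𝒢'.mdifferentiable_src _)]
  simp only [φ.src_onArr]

theorem dtgt_dArr (g : G') (a : EuclideanSpace ℝ (Fin n')) :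
    𝒢.dtgt (φ.onArr g) (φ.dArr g a) = φ.dObj (𝒢'.tgt g) (𝒢'.dtgt g a) := by
  rw [dtgt, dArr, ← modelDeriv_comp_apply g (𝒢.mdifferentiable_tgt _) (φ.mdifferentiable_onArr _),
    dtgt, dObj, ← modelDeriv_comp_apply g (φ.mdifferentiable_onObj _) (𝒢'.mdifferentiable_tgt _)]
  simp only [φ.tgt_onArr]

variable {φ}

theorem IsFullyFaithful.exists_arrow (hφ : φ.IsFullyFaithful) {g : G} {y₁ y₂ : M'}
    (h₁ : 𝒢.src g = φ.onObj y₁) (h₂ : 𝒢.tgt g = φ.onObj y₂) :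
    ∃ g', 𝒢'.src g' = y₁ ∧ 𝒢'.tgt g' = y₂ ∧ φ.onArr g' = g := by
  obtain ⟨ψ, -, -, hψ⟩ := hφ
  have h := hψ ((y₁, y₂), g) ⟨h₁, h₂⟩
  exact ⟨ψ ((y₁, y₂), g), congrArg (fun p => p.1.1) h, congrArg (fun p => p.1.2) h,
    congrArg Prod.snd h⟩

/-- The derivative of the comparison map of a fully faithful morphism is injective. -/
theorem IsFullyFaithful.eq_zero (hφ : φ.IsFullyFaithful) {g : G'} {a : EuclideanSpace ℝ (Fin n')}
    (h₁ : 𝒢'.dsrc g a = 0) (h₂ : 𝒢'.dtgt g a = 0) (h₃ : φ.dArr g a = 0) : a = 0 := by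
  obtain ⟨ψ, hψ, hψ₁, -⟩ := hφ
  have hmem (g : G') : φ.comparison g ∈ φ.fibreProduct := ⟨φ.src_onArr g, φ.tgt_onArr g⟩
  have hd := ((hψ.mdifferentiableOn (by simp)) _ (hmem g)).hasMFDerivWithinAt
  have hc := ((𝒢'.mdifferentiable_src g).hasMFDerivAt.prodMk
    (𝒢'.mdifferentiable_tgt g).hasMFDerivAt).prodMk (φ.mdifferentiable_onArr g).hasMFDerivAt
  have hcomp := HasMFDerivWithinAt.comp g hd hc.hasMFDerivWithinAt (s := Set.univ)
    fun g' _ => hmem g'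
  have hid := (hasMFDerivWithinAt_univ.1 hcomp).mfderiv
  rw [show ψ ∘ φ.comparison = id from funext hψ₁, mfderiv_id] at hid
  have h := congr($hid a)
  have hz : ((𝒢'.dsrc g a, 𝒢'.dtgt g a), φ.dArr g a) = 0 := by rw [h₁, h₂, h₃]; rfl
  exact h.trans ((congrArg (mfderivWithin _ _ ψ _ _) hz).trans (map_zero (mfderivWithin _ _ ψ _ _)))

theorem IsEssentiallySurjective.exists_mem_arrowTangent (hφ : φ.IsEssentiallySurjective) {g : G}
    {y : M'} (h : 𝒢.src g = φ.onObj y) (v : EuclideanSpace ℝ (Fin m)) :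
    ∃ b, (φ.dObj y b, v) ∈ 𝒢.arrowTangent g := by
  obtain ⟨a, b, h₁, h₂⟩ := hφ.submersion g y h v
  exact ⟨b, mem_arrowTangent.2 ⟨a, h₁, h₂⟩⟩

/-- For a Morita map `φ`, every formal tangent vector to the fibre product
`(M' × M') ×_{M × M} G` comes from a tangent vector on `G'`. Essential surjectivity ensures that
`φ × φ` and `(s, t)` are transverse, so that the formal tangent vector is the velocity of a curve in
the fibre product. -/
theorem IsMorita.exists_tangent (hφ : φ.IsMorita) (g : G') {b₁ b₂ : EuclideanSpace ℝ (Fin m')}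
    {a : EuclideanSpace ℝ (Fin n)} (h₁ : 𝒢.dsrc (φ.onArr g) a = φ.dObj (𝒢'.src g) b₁)
    (h₂ : 𝒢.dtgt (φ.onArr g) a = φ.dObj (𝒢'.tgt g) b₂) :
    ∃ a', 𝒢'.dsrc g a' = b₁ ∧ 𝒢'.dtgt g a' = b₂ ∧ φ.dArr g a' = a := by
  let I := ((𝓡 m').prod (𝓡 m')).prod (𝓡 n)
  obtain ⟨ψ, hψ, hψ₁, hψ₂⟩ := hφ.fullyFaithful
  have hmem : φ.comparison g ∈ φ.fibreProduct := ⟨φ.src_onArr g, φ.tgt_onArr g⟩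
  -- the three projections of the ambient manifold of the fibre product
  have s₁ : ContMDiff I (𝓡 m') ∞ (fun p : (M' × M') × G => p.1.1) :=
    contMDiff_fst.comp contMDiff_fst
  have s₂ : ContMDiff I (𝓡 m') ∞ (fun p : (M' × M') × G => p.1.2) :=
    contMDiff_snd.comp contMDiff_fst
  have s₃ : ContMDiff I (𝓡 n) ∞ (fun p : (M' × M') × G => p.2) := contMDiff_snd
  have m₀ : MDifferentiable I ((𝓡 m').prod (𝓡 m')) (fun p : (M' × M') × G => p.1) :=
    contMDiff_fst.mdifferentiable (n := ∞) (by simp)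
  have m₁ := s₁.mdifferentiable (by simp)
  have m₂ := s₂.mdifferentiable (by simp)
  have m₃ := s₃.mdifferentiable (by simp)
  have d₁ (p : (M' × M') × G) (v) :
      modelDeriv I (𝓡 m') (fun p : (M' × M') × G => p.1.1) p v = v.1.1 := by
    rw [modelDeriv_comp_apply (g := Prod.fst) (f := Prod.fst) p
      (contMDiff_fst.mdifferentiable (n := ∞) (by simp) _) (m₀ _)]
    exact congr($(modelDeriv_fst p.1) _).trans congr(($(modelDeriv_fst p) v).1)
  have d₂ (p : (M' × M') × G) (v) :
      modelDeriv I (𝓡 m') (fun p : (M' × M') × G => p.1.2) p v = v.1.2 := by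
    rw [modelDeriv_comp_apply (g := Prod.snd) (f := Prod.fst) p
      (contMDiff_snd.mdifferentiable (n := ∞) (by simp) _) (m₀ _)]
    exact congr($(modelDeriv_snd p.1) _).trans congr(($(modelDeriv_fst p) v).2)
  have d₃ (p : (M' × M') × G) (v) :
      modelDeriv I (𝓡 n) (fun p : (M' × M') × G => p.2) p v = v.2 := congr($(modelDeriv_snd p) v)
  have D₁ (p : (M' × M') × G) (v) : modelDeriv I ((𝓡 m).prod (𝓡 m))
      (fun p : (M' × M') × G => (φ.onObj p.1.1, φ.onObj p.1.2)) p v =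
        (φ.dObj p.1.1 v.1.1, φ.dObj p.1.2 v.1.2) := by
    rw [modelDeriv_prodMk (f := fun p : (M' × M') × G => φ.onObj p.1.1)
        (g := fun p : (M' × M') × G => φ.onObj p.1.2) ((φ.mdifferentiable_onObj _).comp p (m₁ p))
        ((φ.mdifferentiable_onObj _).comp p (m₂ p)), ContinuousLinearMap.prod_apply]
    refine Prod.ext ?_ ?_
    · exact (modelDeriv_comp_apply p (φ.mdifferentiable_onObj _) (m₁ p) v).trans (by rw [d₁]; rfl)
    · exact (modelDeriv_comp_apply p (φ.mdifferentiable_onObj _) (m₂ p) v).trans (by rw [d₂]; rfl)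
  have D₂ (p : (M' × M') × G) (v) : modelDeriv I ((𝓡 m).prod (𝓡 m))
      (fun p : (M' × M') × G => (𝒢.src p.2, 𝒢.tgt p.2)) p v =
        (𝒢.dsrc p.2 v.2, 𝒢.dtgt p.2 v.2) := by
    rw [modelDeriv_prodMk (f := fun p : (M' × M') × G => 𝒢.src p.2)
        (g := fun p : (M' × M') × G => 𝒢.tgt p.2) ((𝒢.mdifferentiable_src _).comp p (m₃ p))
        ((𝒢.mdifferentiable_tgt _).comp p (m₃ p)), ContinuousLinearMap.prod_apply]
    refine Prod.ext ?_ ?_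
    · exact (modelDeriv_comp_apply p (𝒢.mdifferentiable_src _) (m₃ p) v).trans (by rw [d₃]; rfl)
    · exact (modelDeriv_comp_apply p (𝒢.mdifferentiable_tgt _) (m₃ p) v).trans (by rw [d₃]; rfl)
  obtain ⟨c, hc₀, hc, hcv, hce⟩ := exists_curve_of_equalizer
    (I := I) (J := (𝓡 m).prod (𝓡 m)) (p := φ.comparison g) (v := ((b₁, b₂), a))
    (f₁ := fun p : (M' × M') × G => (φ.onObj p.1.1, φ.onObj p.1.2))
    (f₂ := fun p : (M' × M') × G => (𝒢.src p.2, 𝒢.tgt p.2))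
    (((φ.smooth_onObj.comp s₁).prodMk (φ.smooth_onObj.comp s₂)) _)
    (((𝒢.contMDiff_src.comp s₃).prodMk (𝒢.contMDiff_tgt.comp s₃)) _)
    (Prod.ext hmem.1.symm hmem.2.symm)
    (by
      rintro ⟨w₁, w₂⟩
      obtain ⟨z, hz⟩ := 𝒢.dsrc_surjective (φ.onArr g) (-w₁)
      obtain ⟨b, hb⟩ := hφ.essentiallySurjective.exists_mem_arrowTangent (φ.src_onArr g)
        (-w₂ - 𝒢.dtgt (φ.onArr g) z)
      obtain ⟨z', hz₁, hz₂⟩ := mem_arrowTangent.1 hb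
      refine ⟨((b, 0), z + z'), ?_⟩
      rw [D₁, D₂]
      change (φ.dObj (𝒢'.src g) b - 𝒢.dsrc (φ.onArr g) (z + z'),
        φ.dObj (𝒢'.tgt g) 0 - 𝒢.dtgt (φ.onArr g) (z + z')) = _
      rw [map_add, map_add, map_zero, hz, hz₁, hz₂]
      refine Prod.ext ?_ ?_
      · dsimp only; abel
      · dsimp only; abel)
    (by rw [D₁, D₂]; exact Prod.ext h₁.symm h₂.symm)
  have hce' : ∀ᶠ t in 𝓝 0, c t ∈ φ.fibreProduct := hce.mono fun t ht =>
    ⟨(congrArg Prod.fst ht).symm, (congrArg Prod.snd ht).symm⟩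
  have hγ : MDifferentiableAt 𝓘(ℝ, ℝ) (𝓡 n') (fun t => ψ (c t)) 0 := by
    refine MDifferentiableWithinAt.comp_curve ((hψ.mdifferentiableOn (by simp)) (c 0) ?_) hc hce'
    rwa [hc₀]
  have hγ₀ : ψ (c 0) = g := by rw [hc₀, hψ₁]
  refine ⟨modelDeriv 𝓘(ℝ, ℝ) (𝓡 n') (fun t => ψ (c t)) 0 1, ?_, ?_, ?_⟩
  · have key := congr($(modelDeriv_congr (I := 𝓘(ℝ, ℝ)) (J := 𝓡 m')
      (hce'.mono fun t ht => congrArg (fun p => p.1.1) (hψ₂ _ ht))) 1)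
    rw [modelDeriv_comp_apply 0 (m₁ _) hc, d₁, hcv] at key
    refine Eq.trans ?_ key
    rw [← hγ₀]
    exact (modelDeriv_comp_apply (f := fun t => ψ (c t)) 0 (𝒢'.mdifferentiable_src _) hγ 1).symm
  · have key := congr($(modelDeriv_congr (I := 𝓘(ℝ, ℝ)) (J := 𝓡 m')
      (hce'.mono fun t ht => congrArg (fun p => p.1.2) (hψ₂ _ ht))) 1)
    rw [modelDeriv_comp_apply 0 (m₂ _) hc, d₂, hcv] at key
    refine Eq.trans ?_ key
    rw [← hγ₀]
    exact (modelDeriv_comp_apply (f := fun t => ψ (c t)) 0 (𝒢'.mdifferentiable_tgt _) hγ 1).symm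
  · have key := congr($(modelDeriv_congr (I := 𝓘(ℝ, ℝ)) (J := 𝓡 n)
      (hce'.mono fun t ht => congrArg Prod.snd (hψ₂ _ ht))) 1)
    rw [modelDeriv_comp_apply 0 (m₃ _) hc, d₃, hcv] at key
    refine Eq.trans ?_ key
    rw [← hγ₀]
    exact (modelDeriv_comp_apply (f := fun t => ψ (c t)) 0 (φ.mdifferentiable_onArr _) hγ 1).symm

/-- The tangent groupoid of `G'` is the pullback of that of `G` along a Morita map. -/
theorem IsMorita.mem_arrowTangent_iff (hφ : φ.IsMorita) (g : G')
    {b₁ b₂ : EuclideanSpace ℝ (Fin m')} :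
    (b₁, b₂) ∈ 𝒢'.arrowTangent g ↔
      (φ.dObj (𝒢'.src g) b₁, φ.dObj (𝒢'.tgt g) b₂) ∈ 𝒢.arrowTangent (φ.onArr g) := by
  rw [mem_arrowTangent, mem_arrowTangent]
  constructor
  · rintro ⟨a, rfl, rfl⟩
    exact ⟨φ.dArr g a, φ.dsrc_dArr g a, φ.dtgt_dArr g a⟩
  · rintro ⟨a, h₁, h₂⟩
    obtain ⟨a', h₁', h₂', -⟩ := hφ.exists_tangent g h₁ h₂
    exact ⟨a', h₁', h₂'⟩

theorem IsMorita.mem_arrowTangent_unit_iff (hφ : φ.IsMorita) (y : M')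
    {b₁ b₂ : EuclideanSpace ℝ (Fin m')} :
    (b₁, b₂) ∈ 𝒢'.arrowTangent (𝒢'.unit y) ↔
      (φ.dObj y b₁, φ.dObj y b₂) ∈ 𝒢.arrowTangent (𝒢.unit (φ.onObj y)) := by
  rw [hφ.mem_arrowTangent_iff, 𝒢'.src_unit, 𝒢'.tgt_unit, φ.onArr_unit]

theorem IsMorita.anchor_injective_iff (hφ : φ.IsMorita) (y : M') :
    (∀ a, 𝒢'.anchor y a = 0 → a = 0) ↔ ∀ a, 𝒢.anchor (φ.onObj y) a = 0 → a = 0 := by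
  rw [LieGroupoid.anchor_injective_iff, LieGroupoid.anchor_injective_iff, ← φ.onArr_unit]
  constructor
  · intro h a h₁ h₂
    obtain ⟨a', h₁', h₂', rfl⟩ := hφ.exists_tangent (𝒢'.unit y) (b₁ := 0) (b₂ := 0)
      (h₁.trans (map_zero _).symm) (h₂.trans (map_zero _).symm)
    rw [h a' h₁' h₂', map_zero]
  · intro h a h₁ h₂
    refine hφ.fullyFaithful.eq_zero h₁ h₂ (h _ ?_ ?_)
    · rw [dsrc_dArr, h₁, map_zero]
    · rw [dtgt_dArr, h₂, map_zero]

/-! ### Pullback of forms along Morita maps -/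

theorem pullback_atPoint {k : ℕ} (α : FormField m k M) (y : M')
    (b : Fin k → EuclideanSpace ℝ (Fin m')) :
    (φ.pullback α).atPoint y b = α.atPoint (φ.onObj y) fun i => φ.dObj y (b i) := rfl

theorem lichnerowiczForm_pullback (ϖ : FormField m 2 M) (η : FormField m 1 M) (y : M')
    (v w : EuclideanSpace ℝ (Fin m')) :
    lichnerowiczForm (φ.pullback ϖ) (φ.pullback η) y v w =
      lichnerowiczForm ϖ η (φ.onObj y) (φ.dObj y v) (φ.dObj y w) := by
  have h₂ : (fun i => φ.dObj y (![v, w] i)) = ![φ.dObj y v, φ.dObj y w] := by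
    ext1 i; fin_cases i <;> rfl
  have h₁ (z) : (fun i => φ.dObj y (![z] i)) = ![φ.dObj y z] := by
    ext1 i; fin_cases i; rfl
  rw [lichnerowiczForm, pullback_atPoint, pullback_atPoint, pullback_atPoint, h₂, h₁, h₁]
  rfl

/-- For a Morita map, the pulled back Lichnerowicz map is a quasi-isomorphism at `y` if and only if
the original one is a quasi-isomorphism at the image of `y`. -/
theorem IsMorita.quasiIso_pullback_iff (hφ : φ.IsMorita) {ϖ : FormField m 2 M}
    {η : FormField m 1 M} (hϖ : 𝒢.IsBasic ϖ) (hη : 𝒢.IsBasic η) (y : M') :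
    QuasiIso (𝒢'.lichnerowiczMap (φ.isBasic_pullback hϖ) (φ.isBasic_pullback hη) y) ↔
      QuasiIso (𝒢.lichnerowiczMap hϖ hη (φ.onObj y)) := by
  rw [quasiIso_lichnerowiczMap_iff_arrowTangent, quasiIso_lichnerowiczMap_iff_arrowTangent,
    hφ.anchor_injective_iff]
  refine and_congr_right fun _ => ?_
  have flat {u v u' v'} (h : (u, v) ∈ 𝒢.arrowTangent (𝒢.unit (φ.onObj y)))
      (h' : (u', v') ∈ 𝒢.arrowTangent (𝒢.unit (φ.onObj y))) :
      lichnerowiczForm ϖ η (φ.onObj y) v v' = lichnerowiczForm ϖ η (φ.onObj y) u u' := by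
    have := 𝒢.lichnerowiczForm_tgt hϖ hη _ h h'
    rwa [𝒢.tgt_unit, 𝒢.src_unit] at this
  constructor
  · intro H v hv
    obtain ⟨b, hb⟩ := hφ.essentiallySurjective.exists_mem_arrowTangent
      (𝒢.src_unit (φ.onObj y)) v
    have h := H b fun w => by
      rw [lichnerowiczForm_pullback, ← flat hb (𝒢.mem_arrowTangent_unit _ _), hv]
    rw [hφ.mem_arrowTangent_unit_iff, map_zero] at h
    have h' := 𝒢.mem_arrowTangent_mul (by rw [𝒢.src_unit, 𝒢.tgt_unit]) h hb
    have hu := 𝒢.unit_mul (𝒢.unit (φ.onObj y))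
    rw [𝒢.tgt_unit] at hu
    rwa [hu] at h'
  · intro H b hb
    rw [hφ.mem_arrowTangent_unit_iff, map_zero]
    refine H _ fun w => ?_
    obtain ⟨b', hb'⟩ := hφ.essentiallySurjective.exists_mem_arrowTangent
      (𝒢.src_unit (φ.onObj y)) w
    rw [flat (𝒢.mem_arrowTangent_unit _ _) hb', ← lichnerowiczForm_pullback, hb]

theorem IsMorita.forall_quasiIso_iff (hφ : φ.IsMorita) {ϖ : FormField m 2 M}
    {η : FormField m 1 M} (hϖ : 𝒢.IsBasic ϖ) (hη : 𝒢.IsBasic η) :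
    (∀ x, QuasiIso (𝒢.lichnerowiczMap hϖ hη x)) ↔
      ∀ y, QuasiIso (𝒢'.lichnerowiczMap (φ.isBasic_pullback hϖ) (φ.isBasic_pullback hη) y) := by
  refine ⟨fun h y => (hφ.quasiIso_pullback_iff hϖ hη y).2 (h _), fun h x => ?_⟩
  obtain ⟨g, y, hg, rfl⟩ := hφ.essentiallySurjective.surjective x
  refine 𝒢.quasiIso_lichnerowiczMap_tgt hϖ hη g ?_
  rw [hg]
  exact (hφ.quasiIso_pullback_iff hϖ hη y).1 (h y)

/-- A basic form on `M` is determined by its pullback along an essentially surjective morphism. -/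
theorem IsEssentiallySurjective.pullback_injective (hφ : φ.IsEssentiallySurjective) {k : ℕ}
    {α β : FormField m k M} (hα : 𝒢.IsBasic α) (hβ : 𝒢.IsBasic β)
    (h : φ.pullback α = φ.pullback β) : α = β := by
  funext x
  obtain ⟨g, y, hg, rfl⟩ := hφ.surjective x
  refine ContinuousAlternatingMap.ext fun v => ?_
  choose b hb using fun i => hφ.exists_mem_arrowTangent hg (v i)
  have h₁ := 𝒢.isBasic_iff.1 hα g _ _ hb
  have h₂ := 𝒢.isBasic_iff.1 hβ g _ _ hb
  rw [hg] at h₁ h₂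
  have h₃ : (φ.pullback α).atPoint y b = (φ.pullback β).atPoint y b := by rw [h]
  exact h₁.trans (h₃.trans h₂.symm)

/-- A basic form that vanishes at the image of `y` vanishes along the whole orbit, so that the
pullback of a nowhere vanishing basic form along an essentially surjective morphism vanishes
nowhere. -/
theorem IsEssentiallySurjective.pullback_ne_zero (hφ : φ.IsEssentiallySurjective) {k : ℕ}
    {α : FormField m k M} (hα : 𝒢.IsBasic α) (h : ∀ x, α x ≠ 0) (y : M') :
    φ.pullback α y ≠ 0 := by
  intro h₀
  refine h (φ.onObj y) (ContinuousAlternatingMap.ext fun v => ?_)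
  choose b hb using fun i =>
    hφ.exists_mem_arrowTangent (𝒢.src_unit (φ.onObj y)) (v i)
  have h₁ := 𝒢.isBasic_iff.1 hα _ _ _ hb
  rw [𝒢.src_unit, 𝒢.tgt_unit] at h₁
  have h₂ : (φ.pullback α).atPoint y b = 0 := congrArg (fun β => β b) h₀
  exact h₁.trans h₂

theorem IsEssentiallySurjective.ne_zero_of_pullback (hφ : φ.IsEssentiallySurjective) {k : ℕ}
    {α : FormField m k M} (hα : 𝒢.IsBasic α) (h : ∀ y, φ.pullback α y ≠ 0) (x : M) :
    α x ≠ 0 := by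
  intro h₀
  obtain ⟨g, y, hg, rfl⟩ := hφ.surjective x
  refine h y (ContinuousAlternatingMap.ext fun b => ?_)
  choose v hv using fun i => 𝒢.exists_mem_arrowTangent_left g (φ.dObj y (b i))
  have h₁ := 𝒢.isBasic_iff.1 hα g _ _ hv
  rw [hg] at h₁
  exact h₁.symm.trans (congrArg (fun β => β v) h₀)

end LieGroupoid.Hom

/-! ### Local pullbacks of smooth and closed forms -/

section PullbackSmooth

open Filter Topology

variable {E F : Type*} [NormedAddCommGroup E] [NormedSpace ℝ E] [FiniteDimensional ℝ E]
  [NormedAddCommGroup F] [NormedSpace ℝ F]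

/-- A family of alternating forms on a finite-dimensional space is smooth if its values on fixed
vectors are smooth. -/
theorem contDiffAt_continuousAlternatingMap_of_apply {D : Type*} [NormedAddCommGroup D]
    [NormedSpace ℝ D] {ι : Type*} [Fintype ι] {b : D → E [⋀^ι]→L[ℝ] ℝ} {x : D}
    (h : ∀ v : ι → E, ContDiffAt ℝ ∞ (fun u => b u v) x) : ContDiffAt ℝ ∞ b x := by
  classical
  let e := Module.finBasis ℝ E
  -- the values on basis vectors embed the space of forms into a finite-dimensional space
  let ev : (E [⋀^ι]→L[ℝ] ℝ) →ₗ[ℝ] ((ι → Fin (Module.finrank ℝ E)) → ℝ) :=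
    { toFun := fun β i => β fun j => e (i j)
      map_add' := fun _ _ => rfl
      map_smul' := fun _ _ => rfl }
  have hev : LinearMap.ker ev = ⊥ := by
    refine LinearMap.ker_eq_bot.2 fun β γ hβγ => ?_
    have : β.toMultilinearMap = γ.toMultilinearMap :=
      Module.Basis.ext_multilinear (fun _ => e) fun i => congrFun hβγ i
    exact ContinuousAlternatingMap.ext fun v => congrArg (fun f => f v) this
  obtain ⟨R, hR⟩ := LinearMap.exists_leftInverse_of_injective ev hev
  have hb : b = fun u => LinearMap.toContinuousLinearMap R (fun i => b u fun j => e (i j)) :=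
    funext fun u => (congr($hR (b u))).symm
  rw [hb]
  exact (LinearMap.toContinuousLinearMap R).contDiff.contDiffAt.comp x
    (contDiffAt_pi.2 fun i => h _)

/-- The pullback of a smooth family of forms along a smooth family of linear maps is smooth. -/
theorem ContDiffAt.continuousAlternatingMap_compContinuousLinearMap {D : Type*}
    [NormedAddCommGroup D] [NormedSpace ℝ D] {ι : Type*} [Fintype ι]
    {b : D → F [⋀^ι]→L[ℝ] ℝ} {L : D → E →L[ℝ] F} {x : D} (hb : ContDiffAt ℝ ∞ b x)
    (hL : ContDiffAt ℝ ∞ L x) :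
    ContDiffAt ℝ ∞ (fun u => (b u).compContinuousLinearMap (L u)) x := by
  refine contDiffAt_continuousAlternatingMap_of_apply fun v => ?_
  have h₁ : ContDiffAt ℝ ∞ (fun u => ContinuousAlternatingMap.toContinuousMultilinearMapCLM ℝ
      (b u)) x :=
    ContDiffAt.comp (g := ContinuousAlternatingMap.toContinuousMultilinearMapCLM ℝ) x
      (ContinuousLinearMap.contDiff _).contDiffAt hb
  have h₂ : ContDiffAt ℝ ∞ (fun u =>
      ContinuousMultilinearMap.compContinuousLinearMapContinuousMultilinear ℝ
        (fun _ : ι => E) (fun _ => F) ℝ (fun _ => L u)) x :=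
    (ContinuousMultilinearMap.contDiff _).contDiffAt.comp x (contDiffAt_pi.2 fun _ => hL)
  exact (ContinuousMultilinearMap.apply ℝ (fun _ : ι => E) ℝ v).contDiff.contDiffAt.comp x
    (h₂.clm_apply h₁)

end PullbackSmooth

namespace FormField

open Filter Topology

variable {m n k : ℕ} {M N : Type*}
  [TopologicalSpace M] [ChartedSpace (EuclideanSpace ℝ (Fin m)) M] [IsManifold (𝓡 m) ∞ M]
  [TopologicalSpace N] [ChartedSpace (EuclideanSpace ℝ (Fin n)) N]

theorem contDiffAt_localRep {f : M → N} {x₀ : M} {y : EuclideanSpace ℝ (Fin m)}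
    (hy : y ∈ (extChartAt (𝓡 m) x₀).target)
    (hf : ContMDiffAt (𝓡 m) (𝓡 n) ∞ f ((extChartAt (𝓡 m) x₀).symm y)) :
    ContDiffAt ℝ ∞ (fun u => extChartAt (𝓡 n) (f ((extChartAt (𝓡 m) x₀).symm y))
      (f ((extChartAt (𝓡 m) x₀).symm u))) y := by
  rw [← contMDiffAt_iff_contDiffAt]
  refine ContMDiffAt.comp (g := extChartAt (𝓡 n) (f ((extChartAt (𝓡 m) x₀).symm y)))
    (f := fun u => f ((extChartAt (𝓡 m) x₀).symm u)) y contMDiffAt_extChartAt ?_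
  exact ContMDiffAt.comp y hf (contMDiffAt_extChartAt_symm_of_mem hy)

variable [IsManifold (𝓡 n) ∞ N]

/-- In charts, the pullback of a form is the pullback of its local representative along the local
representative of the map. -/
theorem inChart_pullback_eventuallyEq {α : FormField m k M} {β : FormField n k N} {f : M → N}
    {x₀ : M} {y : EuclideanSpace ℝ (Fin m)} (hy : y ∈ (extChartAt (𝓡 m) x₀).target)
    (hf : ContMDiffAt (𝓡 m) (𝓡 n) ∞ f ((extChartAt (𝓡 m) x₀).symm y))
    (hα : ∀ᶠ z in 𝓝 ((extChartAt (𝓡 m) x₀).symm y), α z = β.pullback f z) :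
    α.inChart x₀ =ᶠ[𝓝 y] fun u =>
      (β.inChart (f ((extChartAt (𝓡 m) x₀).symm y))
        (extChartAt (𝓡 n) (f ((extChartAt (𝓡 m) x₀).symm y))
          (f ((extChartAt (𝓡 m) x₀).symm u)))).compContinuousLinearMap
        (fderiv ℝ (fun u => extChartAt (𝓡 n) (f ((extChartAt (𝓡 m) x₀).symm y))
          (f ((extChartAt (𝓡 m) x₀).symm u))) u) := by
  have : IsManifold (𝓡 m) 1 M := IsManifold.of_le (n := ∞) (by simp)
  have : IsManifold (𝓡 n) 1 N := IsManifold.of_le (n := ∞) (by simp)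
  set e₀ := extChartAt (𝓡 m) x₀
  set e₁ := extChartAt (𝓡 n) (f (e₀.symm y)) with he₁
  have ht : ∀ᶠ u in 𝓝 y, u ∈ e₀.target := (isOpen_extChartAt_target x₀).mem_nhds hy
  have hs : ContinuousAt e₀.symm y :=
    (contMDiffAt_extChartAt_symm_of_mem (I := 𝓡 m) hy).continuousAt
  have hf₁ : ∀ᶠ z in 𝓝 (e₀.symm y), ContMDiffAt (𝓡 m) (𝓡 n) 1 f z :=
    (contMDiffAt_iff_contMDiffAt_nhds (by simp)).1 (hf.of_le (by simp))
  have hsrc : ∀ᶠ z in 𝓝 (e₀.symm y), f z ∈ e₁.source :=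
    hf.continuousAt (extChartAt_source_mem_nhds _)
  filter_upwards [ht, hs.eventually hf₁, hs.eventually hsrc, hs.eventually hα] with u hu hfu hsu hαu
  have ds : MDifferentiableAt 𝓘(ℝ, EuclideanSpace ℝ (Fin m)) (𝓡 m) e₀.symm u :=
    (contMDiffAt_extChartAt_symm_of_mem (I := 𝓡 m) hu).mdifferentiableAt (by simp)
  have df : MDifferentiableAt (𝓡 m) (𝓡 n) f (e₀.symm u) := hfu.mdifferentiableAt (by simp)
  have hsu' : f (e₀.symm u) ∈ (chartAt (EuclideanSpace ℝ (Fin n)) (f (e₀.symm y))).source := by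
    rwa [he₁, extChartAt_source] at hsu
  have de : MDifferentiableAt (𝓡 n) 𝓘(ℝ, EuclideanSpace ℝ (Fin n)) e₁ (f (e₀.symm u)) :=
    (contMDiffAt_extChartAt' (n := ∞) hsu').mdifferentiableAt (by simp)
  have dfs : MDifferentiableAt 𝓘(ℝ, EuclideanSpace ℝ (Fin m)) (𝓡 n) (fun u => f (e₀.symm u)) u :=
    df.comp u ds
  have hder : fderiv ℝ (fun u => e₁ (f (e₀.symm u))) u =
      (modelDeriv (𝓡 n) 𝓘(ℝ, EuclideanSpace ℝ (Fin n)) e₁ (f (e₀.symm u))).comp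
        ((modelDeriv (𝓡 m) (𝓡 n) f (e₀.symm u)).comp
          (modelDeriv 𝓘(ℝ, EuclideanSpace ℝ (Fin m)) (𝓡 m) e₀.symm u)) := by
    rw [← modelDeriv_eq_fderiv, modelDeriv_comp (f := fun u => f (e₀.symm u)) u de dfs,
      modelDeriv_comp u df ds]
  have hinv := modelDeriv_extChartAt_symm_comp (I := 𝓡 n) hsu
  refine ContinuousAlternatingMap.ext fun w => ?_
  have lhs : α.inChart x₀ u w = β.atPoint (f (e₀.symm u)) fun i =>
      modelDeriv (𝓡 m) (𝓡 n) f (e₀.symm u)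
        (modelDeriv 𝓘(ℝ, EuclideanSpace ℝ (Fin m)) (𝓡 m) e₀.symm u (w i)) :=
    congrArg (fun γ => γ fun i =>
      modelDeriv 𝓘(ℝ, EuclideanSpace ℝ (Fin m)) (𝓡 m) e₀.symm u (w i)) hαu
  have rhs (w : Fin k → EuclideanSpace ℝ (Fin n)) :
      β.inChart (f (e₀.symm y)) (e₁ (f (e₀.symm u))) w =
        β.atPoint (e₁.symm (e₁ (f (e₀.symm u)))) fun i =>
          modelDeriv 𝓘(ℝ, EuclideanSpace ℝ (Fin n)) (𝓡 n) e₁.symm (e₁ (f (e₀.symm u))) (w i) := rfl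
  have hinv' (v : EuclideanSpace ℝ (Fin n)) :
      modelDeriv 𝓘(ℝ, EuclideanSpace ℝ (Fin n)) (𝓡 n) e₁.symm (e₁ (f (e₀.symm u)))
        (modelDeriv (𝓡 n) 𝓘(ℝ, EuclideanSpace ℝ (Fin n)) e₁ (f (e₀.symm u)) v) = v :=
    congr($hinv v)
  rw [lhs, ContinuousAlternatingMap.compContinuousLinearMap_apply, rhs, e₁.left_inv hsu, hder]
  congr 1
  funext i
  exact (hinv' _).symm

/-- A field of forms that is locally a pullback of smooth forms is smooth. -/
theorem isSmooth_of_locally_pullback {α : FormField m k M} {β : FormField n k N}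
    (hβ : β.IsSmooth)
    (h : ∀ x, ∃ f : M → N, ContMDiffAt (𝓡 m) (𝓡 n) ∞ f x ∧ ∀ᶠ z in 𝓝 x, α z = β.pullback f z) :
    α.IsSmooth := by
  intro x₀ y hy
  obtain ⟨f, hf, hα⟩ := h ((extChartAt (𝓡 m) x₀).symm y)
  refine ContDiffAt.contDiffWithinAt ?_
  refine ContDiffAt.congr_of_eventuallyEq ?_ (inChart_pullback_eventuallyEq hy hf hα)
  have hh := (contDiffAt_localRep hy hf)
  have hb := (hβ (f ((extChartAt (𝓡 m) x₀).symm y))).contDiffAt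
    ((isOpen_extChartAt_target _).mem_nhds (mem_extChartAt_target _))
  exact ContDiffAt.continuousAlternatingMap_compContinuousLinearMap
    (ContDiffAt.comp (g := β.inChart (f ((extChartAt (𝓡 m) x₀).symm y))) y hb hh)
    (hh.fderiv_right (by simp))

/-- A field of forms that is locally a pullback of smooth closed forms is closed. -/
theorem isClosed_of_locally_pullback {α : FormField m k M} {β : FormField n k N}
    (hβ : β.IsSmooth) (hβ' : β.IsClosed)
    (h : ∀ x, ∃ f : M → N, ContMDiffAt (𝓡 m) (𝓡 n) ∞ f x ∧ ∀ᶠ z in 𝓝 x, α z = β.pullback f z) :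
    α.IsClosed := by
  intro x₀ y hy
  obtain ⟨f, hf, hα⟩ := h ((extChartAt (𝓡 m) x₀).symm y)
  have hh := (contDiffAt_localRep hy hf)
  have hb := (hβ (f ((extChartAt (𝓡 m) x₀).symm y))).contDiffAt
    ((isOpen_extChartAt_target _).mem_nhds (mem_extChartAt_target _))
  rw [(inChart_pullback_eventuallyEq hy hf hα).extDeriv_eq]
  refine (extDeriv_pullback (x := y)
    (f := fun u => extChartAt (𝓡 n) (f ((extChartAt (𝓡 m) x₀).symm y))
      (f ((extChartAt (𝓡 m) x₀).symm u)))
    (hb.differentiableAt (by simp)) (contDiffAt_infty.1 hh 2) (by simp)).trans ?_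
  rw [hβ' _ _ (mem_extChartAt_target _)]
  rfl

theorem IsSmooth.pullback {β : FormField n k N} (hβ : β.IsSmooth) {f : M → N}
    (hf : ContMDiff (𝓡 m) (𝓡 n) ∞ f) : (β.pullback (n := m) f).IsSmooth :=
  isSmooth_of_locally_pullback hβ fun x => ⟨f, hf x, Eventually.of_forall fun _ => rfl⟩

theorem IsClosed.pullback {β : FormField n k N} (hβ' : β.IsClosed) (hβ : β.IsSmooth) {f : M → N}
    (hf : ContMDiff (𝓡 m) (𝓡 n) ∞ f) : (β.pullback (n := m) f).IsClosed :=
  isClosed_of_locally_pullback hβ hβ' fun x => ⟨f, hf x, Eventually.of_forall fun _ => rfl⟩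

end FormField

/-! ### Descent of basic forms along Morita maps -/

namespace LieGroupoid.Hom

open Filter Topology Module

variable {m n : ℕ} {M G : Type*}
  [TopologicalSpace M] [ChartedSpace (EuclideanSpace ℝ (Fin m)) M] [IsManifold (𝓡 m) ∞ M]
  [TopologicalSpace G] [ChartedSpace (EuclideanSpace ℝ (Fin n)) G] [IsManifold (𝓡 n) ∞ G]
  {m' n' : ℕ} {M' G' : Type*}
  [TopologicalSpace M'] [ChartedSpace (EuclideanSpace ℝ (Fin m')) M'] [IsManifold (𝓡 m') ∞ M']
  [TopologicalSpace G'] [ChartedSpace (EuclideanSpace ℝ (Fin n')) G'] [IsManifold (𝓡 n') ∞ G']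
  {𝒢' : LieGroupoid m' n' M' G'} {𝒢 : LieGroupoid m n M G} {φ : Hom 𝒢' 𝒢}

/-- Every point `x` of `M` is the target of an arrow `g` whose source is the image of some `y`, and
the vectors at `x` can be transported linearly along `g` and lifted to `y`. -/
theorem IsEssentiallySurjective.exists_linear_lift (hφ : φ.IsEssentiallySurjective) (x : M) :
    ∃ p : G × M' × (EuclideanSpace ℝ (Fin m) →L[ℝ] EuclideanSpace ℝ (Fin m')),
      𝒢.src p.1 = φ.onObj p.2.1 ∧ 𝒢.tgt p.1 = x ∧
        ∀ v, (φ.dObj p.2.1 (p.2.2 v), v) ∈ 𝒢.arrowTangent p.1 := by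
  obtain ⟨g, y, hg, rfl⟩ := hφ.surjective x
  let S : Submodule ℝ (EuclideanSpace ℝ (Fin m') × EuclideanSpace ℝ (Fin m)) :=
    (𝒢.arrowTangent g).comap (LinearMap.prodMap (φ.dObj y).toLinearMap LinearMap.id)
  let f := (LinearMap.snd ℝ _ _).domRestrict S
  have hf : LinearMap.range f = ⊤ := by
    rw [LinearMap.range_eq_top]
    intro v
    obtain ⟨b, hb⟩ := hφ.exists_mem_arrowTangent hg v
    exact ⟨⟨(b, v), hb⟩, rfl⟩
  obtain ⟨R, hR⟩ := LinearMap.exists_rightInverse_of_surjective f hf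
  refine ⟨(g, y, LinearMap.toContinuousLinearMap (LinearMap.fst ℝ _ _ ∘ₗ S.subtype ∘ₗ R)), hg, rfl,
    fun v => ?_⟩
  have h₁ : (φ.dObj y (R v).1.1, (R v).1.2) ∈ 𝒢.arrowTangent g := (R v).2
  rwa [show (R v).1.2 = v from congr($hR v)] at h₁

/-- The form on `M` to which a form on `M'` descends along an essentially surjective morphism: its
value at `x` is computed by transporting vectors along an arrow from the image of some `y` to `x` and
lifting them to `y`. It only has a meaning independent of these choices for basic forms and Morita
maps. -/
def descend (hφ : φ.IsEssentiallySurjective) {k : ℕ} (α : FormField m' k M') : FormField m k M :=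
  fun x => (α.atPoint (hφ.exists_linear_lift x).choose.2.1).compContinuousLinearMap
    (hφ.exists_linear_lift x).choose.2.2

/-- Different choices of arrows and lifts differ by a tangent vector of `G`, which lifts to `G'`
since `φ` is fully faithful; hence a basic form cannot distinguish them. -/
theorem IsMorita.atPoint_eq (hφ : φ.IsMorita) {k : ℕ} {α : FormField m' k M'}
    (hα : 𝒢'.IsBasic α) {g₁ g₂ : G} {y₁ y₂ : M'} (h₁ : 𝒢.src g₁ = φ.onObj y₁)
    (h₂ : 𝒢.src g₂ = φ.onObj y₂) (h : 𝒢.tgt g₁ = 𝒢.tgt g₂)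
    {b₁ b₂ : Fin k → EuclideanSpace ℝ (Fin m')} {v : Fin k → EuclideanSpace ℝ (Fin m)}
    (hb₁ : ∀ i, (φ.dObj y₁ (b₁ i), v i) ∈ 𝒢.arrowTangent g₁)
    (hb₂ : ∀ i, (φ.dObj y₂ (b₂ i), v i) ∈ 𝒢.arrowTangent g₂) :
    α.atPoint y₁ b₁ = α.atPoint y₂ b₂ := by
  have hc : 𝒢.src (𝒢.inv g₂) = 𝒢.tgt g₁ := (𝒢.src_inv g₂).trans h.symm
  have hb (i) : (φ.dObj y₁ (b₁ i), φ.dObj y₂ (b₂ i)) ∈ 𝒢.arrowTangent (𝒢.mul (𝒢.inv g₂) g₁) :=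
    𝒢.mem_arrowTangent_mul hc (hb₁ i) (𝒢.mem_arrowTangent_inv (hb₂ i))
  obtain ⟨k, rfl, rfl, hk⟩ := hφ.fullyFaithful.exists_arrow
    ((𝒢.src_mul _ _ hc).trans h₁) ((𝒢.tgt_mul _ _ hc).trans ((𝒢.tgt_inv g₂).trans h₂))
  refine (𝒢'.isBasic_iff.1 hα k b₁ b₂ fun i => ?_).symm
  rw [hφ.mem_arrowTangent_iff, hk]
  exact hb i

theorem IsMorita.descend_atPoint (hφ : φ.IsMorita) {k : ℕ} {α : FormField m' k M'}
    (hα : 𝒢'.IsBasic α) {g : G} {y : M'} (h : 𝒢.src g = φ.onObj y)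
    {b : Fin k → EuclideanSpace ℝ (Fin m')} {v : Fin k → EuclideanSpace ℝ (Fin m)}
    (hb : ∀ i, (φ.dObj y (b i), v i) ∈ 𝒢.arrowTangent g) :
    (descend hφ.essentiallySurjective α).atPoint (𝒢.tgt g) v = α.atPoint y b := by
  obtain ⟨h₁, h₂, h₃⟩ := (hφ.essentiallySurjective.exists_linear_lift (𝒢.tgt g)).choose_spec
  exact hφ.atPoint_eq hα h₁ h h₂ (fun i => h₃ (v i)) hb

theorem IsMorita.isBasic_descend (hφ : φ.IsMorita) {k : ℕ} {α : FormField m' k M'}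
    (hα : 𝒢'.IsBasic α) : 𝒢.IsBasic (descend hφ.essentiallySurjective α) := by
  rw [isBasic_iff]
  intro h u v huv
  obtain ⟨g, y, hg, hgh⟩ := hφ.essentiallySurjective.surjective (𝒢.src h)
  choose b hb using fun i => hφ.essentiallySurjective.exists_mem_arrowTangent hg (u i)
  have hc : 𝒢.src h = 𝒢.tgt g := hgh.symm
  have e₁ := hφ.descend_atPoint hα hg hb
  have e₂ := hφ.descend_atPoint hα ((𝒢.src_mul _ _ hc).trans hg)
    fun i => 𝒢.mem_arrowTangent_mul hc (hb i) (huv i)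
  rw [𝒢.tgt_mul _ _ hc] at e₂
  rw [e₂, ← e₁, hc]

theorem IsMorita.pullback_descend (hφ : φ.IsMorita) {k : ℕ} {α : FormField m' k M'}
    (hα : 𝒢'.IsBasic α) : φ.pullback (descend hφ.essentiallySurjective α) = α := by
  funext y
  refine ContinuousAlternatingMap.ext fun b => ?_
  have h := hφ.descend_atPoint hα (𝒢.src_unit (φ.onObj y))
    (fun i => 𝒢.mem_arrowTangent_unit (φ.onObj y) (φ.dObj y (b i)))
  rw [𝒢.tgt_unit] at h
  exact h

/-- Locally, the descended form is the pullback of the original one along a smooth map, which comes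
from a local section of the submersion `G ×_M M' → M`. -/
theorem IsMorita.descend_eq_pullback (hφ : φ.IsMorita) {k : ℕ} {α : FormField m' k M'}
    (hα : 𝒢'.IsBasic α) (x : M) :
    ∃ f : M → M', ContMDiffAt (𝓡 m) (𝓡 m') ∞ f x ∧
      ∀ᶠ z in 𝓝 x, descend hφ.essentiallySurjective α z = α.pullback f z := by
  obtain ⟨g, y, hg, rfl⟩ := hφ.essentiallySurjective.surjective x
  have m₁ : MDifferentiable ((𝓡 n).prod (𝓡 m')) (𝓡 n) (fun p : G × M' => p.1) :=
    contMDiff_fst.mdifferentiable (n := ∞) (by simp)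
  have m₂ : MDifferentiable ((𝓡 n).prod (𝓡 m')) (𝓡 m') (fun p : G × M' => p.2) :=
    contMDiff_snd.mdifferentiable (n := ∞) (by simp)
  have d₁ : modelDeriv ((𝓡 n).prod (𝓡 m')) (𝓡 m) (fun p : G × M' => 𝒢.src p.1) (g, y) =
      (𝒢.dsrc g).comp (.fst ℝ _ _) := by
    rw [modelDeriv_comp _ (𝒢.mdifferentiable_src _) (m₁ _), modelDeriv_fst]; rfl
  have d₂ : modelDeriv ((𝓡 n).prod (𝓡 m')) (𝓡 m) (fun p : G × M' => φ.onObj p.2) (g, y) =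
      (φ.dObj y).comp (.snd ℝ _ _) := by
    rw [modelDeriv_comp _ (φ.mdifferentiable_onObj _) (m₂ _), modelDeriv_snd]; rfl
  have d₃ : modelDeriv ((𝓡 n).prod (𝓡 m')) (𝓡 m) (fun p : G × M' => 𝒢.tgt p.1) (g, y) =
      (𝒢.dtgt g).comp (.fst ℝ _ _) := by
    rw [modelDeriv_comp _ (𝒢.mdifferentiable_tgt _) (m₁ _), modelDeriv_fst]; rfl
  obtain ⟨σ, hσ, -, hσe⟩ := exists_contMDiffAt_section_of_equalizer
    (I := (𝓡 n).prod (𝓡 m')) (J := 𝓡 m) (I' := 𝓡 m) (p := (g, y))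
    (f₁ := fun p : G × M' => 𝒢.src p.1) (f₂ := fun p : G × M' => φ.onObj p.2)
    (h := fun p : G × M' => 𝒢.tgt p.1)
    ((𝒢.contMDiff_src.comp contMDiff_fst) _) ((φ.smooth_onObj.comp contMDiff_snd) _)
    ((𝒢.contMDiff_tgt.comp contMDiff_fst) _) hg
    (by
      intro w u
      obtain ⟨a, ha⟩ := 𝒢.dsrc_surjective g w
      obtain ⟨b, hb⟩ := hφ.essentiallySurjective.exists_mem_arrowTangent hg (u - 𝒢.dtgt g a)
      obtain ⟨a', ha₁, ha₂⟩ := mem_arrowTangent.1 hb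
      refine ⟨(a + a', b), ?_, ?_⟩
      · rw [d₁, d₂]
        change 𝒢.dsrc g (a + a') - φ.dObj y b = w
        rw [map_add, ha, ha₁, add_sub_cancel_right]
      · rw [d₃]
        change 𝒢.dtgt g (a + a') = u
        rw [map_add, ha₂, add_sub_cancel])
  refine ⟨fun z => (σ z).2, contMDiffAt_snd.comp _ hσ, ?_⟩
  have : IsManifold (𝓡 m) 1 M := IsManifold.of_le (n := ∞) (by simp)
  have : IsManifold ((𝓡 n).prod (𝓡 m')) 1 (G × M') := IsManifold.of_le (n := ∞) (by simp)
  have hσ₁ : ∀ᶠ z in 𝓝 (𝒢.tgt g), ContMDiffAt (𝓡 m) ((𝓡 n).prod (𝓡 m')) 1 σ z :=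
    (contMDiffAt_iff_contMDiffAt_nhds (by simp)).1 (hσ.of_le (by simp))
  filter_upwards [hσ₁, hσe.eventually_nhds] with z hz hze
  have hσz : MDifferentiableAt (𝓡 m) ((𝓡 n).prod (𝓡 m')) σ z := hz.mdifferentiableAt (by simp)
  have hσ₁z : MDifferentiableAt (𝓡 m) (𝓡 n) (fun z => (σ z).1) z := (m₁ _).comp z hσz
  have hσ₂z : MDifferentiableAt (𝓡 m) (𝓡 m') (fun z => (σ z).2) z := (m₂ _).comp z hσz
  obtain ⟨hsz, htz⟩ := hze.self_of_nhds
  refine ContinuousAlternatingMap.ext fun v => ?_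
  have key (v : EuclideanSpace ℝ (Fin m)) :
      (φ.dObj (σ z).2 (modelDeriv (𝓡 m) (𝓡 m') (fun z => (σ z).2) z v), v) ∈
        𝒢.arrowTangent (σ z).1 := by
    refine mem_arrowTangent.2 ⟨modelDeriv (𝓡 m) (𝓡 n) (fun z => (σ z).1) z v, ?_, ?_⟩
    · have h := congr($(modelDeriv_congr (I := 𝓡 m) (J := 𝓡 m) (hze.mono fun z h => h.1)) v)
      rwa [modelDeriv_comp_apply z (𝒢.mdifferentiable_src _) hσ₁z,
        modelDeriv_comp_apply z (φ.mdifferentiable_onObj _) hσ₂z] at h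
    · have h := congr($(modelDeriv_congr (I := 𝓡 m) (J := 𝓡 m) (hze.mono fun z h => h.2)) v)
      rwa [modelDeriv_comp_apply z (𝒢.mdifferentiable_tgt _) hσ₁z, modelDeriv_id] at h
  have h := hφ.descend_atPoint hα hsz fun i => key (v i)
  rw [htz] at h
  exact h

theorem IsMorita.isSmooth_descend (hφ : φ.IsMorita) {k : ℕ} {α : FormField m' k M'}
    (hα : 𝒢'.IsBasic α) (hs : α.IsSmooth) : (descend hφ.essentiallySurjective α).IsSmooth :=
  FormField.isSmooth_of_locally_pullback hs (hφ.descend_eq_pullback hα)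

theorem IsMorita.isClosed_descend (hφ : φ.IsMorita) {k : ℕ} {α : FormField m' k M'}
    (hα : 𝒢'.IsBasic α) (hs : α.IsSmooth) (hc : α.IsClosed) :
    (descend hφ.essentiallySurjective α).IsClosed :=
  FormField.isClosed_of_locally_pullback hs hc (hφ.descend_eq_pullback hα)

theorem mapsTo_basicForms (φ : Hom 𝒢' 𝒢) (k : ℕ) :
    Set.MapsTo φ.pullback (𝒢.basicForms k) (𝒢'.basicForms k) :=
  fun _ hα => ⟨hα.1.pullback φ.smooth_onObj, φ.isBasic_pullback hα.2⟩

/-- Closedness, nonvanishing and the quasi-isomorphism condition descend along a Morita map together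
with the forms. -/
theorem IsMorita.isZeroShiftedCosymplectic_descend (hφ : φ.IsMorita) {ϖ : FormField m' 2 M'}
    {η : FormField m' 1 M'} (h : 𝒢'.IsZeroShiftedCosymplectic ϖ η) :
    𝒢.IsZeroShiftedCosymplectic (descend hφ.essentiallySurjective ϖ)
      (descend hφ.essentiallySurjective η) where
  smooth_two := hφ.isSmooth_descend h.basic_two h.smooth_two
  smooth_one := hφ.isSmooth_descend h.basic_one h.smooth_one
  closed_two := hφ.isClosed_descend h.basic_two h.smooth_two h.closed_two
  closed_one := hφ.isClosed_descend h.basic_one h.smooth_one h.closed_one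
  basic_two := hφ.isBasic_descend h.basic_two
  basic_one := hφ.isBasic_descend h.basic_one
  nonvanishing := hφ.essentiallySurjective.ne_zero_of_pullback (hφ.isBasic_descend h.basic_one)
    (by rw [hφ.pullback_descend h.basic_one]; exact h.nonvanishing)
  quasiIso := by
    rw [hφ.forall_quasiIso_iff]
    intro y
    have hy := h.quasiIso y
    rw [quasiIso_lichnerowiczMap_iff_arrowTangent] at hy ⊢
    rwa [hφ.pullback_descend h.basic_one, hφ.pullback_descend h.basic_two]

theorem IsMorita.isZeroShiftedCosymplectic_pullback (hφ : φ.IsMorita) {ϖ : FormField m 2 M}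
    {η : FormField m 1 M} (h : 𝒢.IsZeroShiftedCosymplectic ϖ η) :
    𝒢'.IsZeroShiftedCosymplectic (φ.pullback ϖ) (φ.pullback η) where
  smooth_two := h.smooth_two.pullback φ.smooth_onObj
  smooth_one := h.smooth_one.pullback φ.smooth_onObj
  closed_two := h.closed_two.pullback h.smooth_two φ.smooth_onObj
  closed_one := h.closed_one.pullback h.smooth_one φ.smooth_onObj
  basic_two := φ.isBasic_pullback h.basic_two
  basic_one := φ.isBasic_pullback h.basic_one
  nonvanishing := hφ.essentiallySurjective.pullback_ne_zero h.basic_one h.nonvanishing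
  quasiIso := (hφ.forall_quasiIso_iff h.basic_two h.basic_one).1 h.quasiIso

theorem IsMorita.bijOn_zeroShiftedCosymplectic (hφ : φ.IsMorita) :
    Set.BijOn (fun p : FormField m 2 M × FormField m 1 M => (φ.pullback p.1, φ.pullback p.2))
      𝒢.zeroShiftedCosymplectic 𝒢'.zeroShiftedCosymplectic := by
  refine ⟨fun p hp => hφ.isZeroShiftedCosymplectic_pullback hp, fun p hp q hq h => ?_,
    fun p hp => ⟨(descend hφ.essentiallySurjective p.1, descend hφ.essentiallySurjective p.2),
      hφ.isZeroShiftedCosymplectic_descend hp, ?_⟩⟩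
  · exact Prod.ext
      (hφ.essentiallySurjective.pullback_injective hp.basic_two hq.basic_two (congrArg Prod.fst h))
      (hφ.essentiallySurjective.pullback_injective hp.basic_one hq.basic_one (congrArg Prod.snd h))
  · exact Prod.ext (hφ.pullback_descend hp.basic_two) (hφ.pullback_descend hp.basic_one)

end LieGroupoid.Hom

end

theorem proposition3p2 {m n : ℕ} {M : Type*} {G : Type*}
    [TopologicalSpace M] [ChartedSpace (EuclideanSpace ℝ (Fin m)) M] [IsManifold (𝓡 m) ∞ M]
    [TopologicalSpace G] [ChartedSpace (EuclideanSpace ℝ (Fin n)) G] [IsManifold (𝓡 n) ∞ G]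
    (𝒢 : LieGroupoid m n M G) :
    -- being a quasi-isomorphism is a property of whole orbits
    (∀ (ϖ : FormField m 2 M) (η : FormField m 1 M), ϖ.IsSmooth → η.IsSmooth →
      ϖ.IsClosed → η.IsClosed → ∀ (hϖ : 𝒢.IsBasic ϖ) (hη : 𝒢.IsBasic η) (x : M),
      QuasiIso (𝒢.lichnerowiczMap hϖ hη x) →
        ∀ y ∈ 𝒢.orbit x, QuasiIso (𝒢.lichnerowiczMap hϖ hη y)) ∧
    ∀ {m' n' : ℕ} {M' : Type*} {G' : Type*}
      [TopologicalSpace M'] [ChartedSpace (EuclideanSpace ℝ (Fin m')) M']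
      [IsManifold (𝓡 m') ∞ M']
      [TopologicalSpace G'] [ChartedSpace (EuclideanSpace ℝ (Fin n')) G']
      [IsManifold (𝓡 n') ∞ G']
      (𝒢' : LieGroupoid m' n' M' G') (φ : LieGroupoid.Hom 𝒢' 𝒢), φ.IsMorita →
      -- being a quasi-isomorphism at all points is preserved and reflected by Morita maps
      (∀ (ϖ : FormField m 2 M) (η : FormField m 1 M), ϖ.IsSmooth → η.IsSmooth →
        ϖ.IsClosed → η.IsClosed → ∀ (hϖ : 𝒢.IsBasic ϖ) (hη : 𝒢.IsBasic η),
        (∀ x : M, QuasiIso (𝒢.lichnerowiczMap hϖ hη x)) ↔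
          ∀ x' : M', QuasiIso
            (𝒢'.lichnerowiczMap (φ.isBasic_pullback hϖ) (φ.isBasic_pullback hη) x')) ∧
      -- pullback maps basic forms to basic forms, and restricts to a bijection between the sets
      -- of `0`-shifted cosymplectic structures
      (∀ k : ℕ, Set.MapsTo φ.pullback (𝒢.basicForms k) (𝒢'.basicForms k)) ∧
      Set.BijOn (fun p : FormField m 2 M × FormField m 1 M => (φ.pullback p.1, φ.pullback p.2))
        𝒢.zeroShiftedCosymplectic 𝒢'.zeroShiftedCosymplectic := by
  refine ⟨fun ϖ η _ _ _ _ hϖ hη x hx y hy => ?_, fun 𝒢' φ hφ => ⟨?_, ?_, ?_⟩⟩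
  · obtain ⟨g, rfl, rfl⟩ := hy
    exact 𝒢.quasiIso_lichnerowiczMap_tgt hϖ hη g hx
  · exact fun ϖ η _ _ _ _ hϖ hη => hφ.forall_quasiIso_iff hϖ hη
  · exact φ.mapsTo_basicForms
  · exact hφ.bijOn_zeroShiftedCosymplectic
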